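/- For $n\in\mathbb N=\{1,2,\dots\}$ let $\Phi_n$ be the class of continuous functions $f:[0,\infty)\to\mathbb R$ such that $\sum_{k,l} f(|x_k-x_l|)\,\xi_l\overline{\xi_k}\ge 0$ for all finite families $x_1,\dots,x_N\in\mathbb R^n$ and $\xi_1,\dots,\xi_N\in\mathbb C$, where $|\cdot|$ is the Euclidean norm. Put $$\Omega_n(s)=\sum_{i=0}^\infty\frac{\Gamma(n/2)}{i!\,\Gamma(i+n/2)}\Bigl(-\frac{s^2}{4}\Bigr)^i .$$ The Schoenberg measure of $f\in\Phi_n$ is the finite positive Borel measure $\nu_n$ on $[0,\infty)$ with $f(r)=\int_{[0,\infty)}\Omega_n(rt)\,\nu_n(dt)$ for all $r\ge 0$. For $k\ge 1$, $AC^k_{\rm loc}(0,\infty)$ is the set of $g\in C^{k-1}(0,\infty)$ such that $g^{(k-1)}$ is absolutely continuous on every compact interval $[a,b]\subset(0,\infty)$. **Theorem.** Let $m,j\in\mathbb N$, and let $f\in\Phi_m\cap\Phi_{m+2j}$ be nonconstant, with Schoenberg measures $\nu_m$ and $\nu=\nu_{m+2j}$. Put $$p_m(x)=\frac{2x^{m-1}}{B(\frac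 m2,j)}\int_{(x,\infty)}\Bigl(1-\frac{x^2}{u^2}\Bigr)^{j-1}\frac{\nu(du)}{u^m},$$ where $B$ is the Euler beta function. Then $\nu_m(dx)=p_m(x)\,dx$ on $(0,\infty)$, and the following hold. (i) The distribution function $F(x)=\nu_m([0,x])$ is absolutely continuous on $[0,a]$ for every $a>0$ and belongs to $AC^j_{\rm loc}(0,\infty)$; if $j\ge 2$, then $p_m\in AC^{j-1}_{\rm loc}(0,\infty)$. (ii) If $\nu=p_{m+2j}\,dx$ is absolutely continuous on $(0,\infty)$ with $p_{m+2j}\in L^p(0,\infty)$ for some $1\le p<\infty$, then $p_m\in C^{j-1}(0,\infty)$, and for $k=0,1,\dots,j-1$ $$x^kp_m^{(k)}(x)\in L^p(0,\infty),\qquad p_m^{(k)}(x)=o\bigl(x^{-k-1}\bigr),\quad x\to\infty .$$ (iii) If $I:=\int_{(0,\infty)}\frac{\nu(du)}{u}<\infty$, then $p_m(0)=\lim_{x\to0+}p_m(x)=0$ when $m\ge2$, and $p_1(0)=\lim_{x\to0+}p_1(x)=\dfrac{2}{B(\frac12,j)}\,I$ when $m=1$ (that is, $I$ when $j=1$). Moreover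 $x^kp_m^{(k)}(x)\in L^\infty(0,\infty)$ for $k=0,1,\dots,j-1$ (for $k=j-1\ge1$ the derivative exists almost everywhere). -/

import Mathlib

open MeasureTheory Set Filter Topology

noncomputable section

open scoped ComplexOrder in
/-- The class `Φ_n`: `f`, viewed as a function on `[0,∞)` (its values at negative arguments play no
role), is real-valued, continuous, and `f(|x|)` is positive definite on Euclidean `ℝⁿ`. -/
def IsRPD (n : ℕ) (f : ℝ → ℝ) : Prop :=
  ContinuousOn f (Ici 0) ∧
    ∀ (N : ℕ) (x : Fin N → EuclideanSpace ℝ (Fin n)) (ξ : Fin N → ℂ),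
      0 ≤ ∑ k, ∑ l, (f ‖x k - x l‖ : ℂ) * ξ l * (starRingEnd ℂ) (ξ k)

/-- The Schoenberg kernel `Ω_n(s) = ∑_i Γ(q+1) / (i! Γ(i+q+1)) (-s²/4)^i`, with `q + 1 = n/2`. -/
def schoenbergKernel (n : ℕ) (s : ℝ) : ℝ :=
  ∑' i : ℕ, Real.Gamma (n / 2) / (i.factorial * Real.Gamma (i + n / 2)) * (-(s ^ 2) / 4) ^ i

/-- `ν` is the Schoenberg measure of `f` in dimension `n`: a finite Borel measure on `[0,∞)`
(seen as a measure on `ℝ` that does not charge the negative half-line) which represents `f`.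
Its total mass is `f 0`, so it is a probability measure exactly when `f 0 = 1`. -/
structure IsSchoenbergMeasure (n : ℕ) (f : ℝ → ℝ) (ν : Measure ℝ) : Prop where
  finite : IsFiniteMeasure ν
  support : ν (Iio 0) = 0
  repr : ∀ r : ℝ, 0 ≤ r → f r = ∫ t, schoenbergKernel n (r * t) ∂ν

/-- `AC_loc(0,∞)`: absolute continuity on each compact subinterval of `(0,∞)`. -/
def IsACLoc (g : ℝ → ℝ) : Prop :=
  ∀ a b : ℝ, 0 < a → a ≤ b → AbsolutelyContinuousOnInterval g a b

/-- `AC^k_loc(0,∞)` for `k ≥ 1`: `g` is of class `C^{k-1}` on `(0,∞)` and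
`g^{(k-1)}` is in `AC_loc(0,∞)`. -/
def IsACLocPow (k : ℕ) (g : ℝ → ℝ) : Prop :=
  ContDiffOn ℝ ((k - 1 : ℕ) : ℕ∞) g (Ioi 0) ∧ IsACLoc (iteratedDeriv (k - 1) g)

/-- The density of the `2j`-step transition formula (`j ≥ 1`), `x ≥ 0`:
`p_m(x) = 2 x^{m-1} / B(m/2, j) ∫_x^∞ (1 - x²/u²)^{j-1} u^{-m} ν(du)`. -/
def transitionDensity (m j : ℕ) (ν : Measure ℝ) (x : ℝ) : ℝ :=
  2 * x ^ (m - 1) / ProbabilityTheory.beta (m / 2) j *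
    ∫ u in Ioi x, (1 - x ^ 2 / u ^ 2) ^ (j - 1) / u ^ m ∂ν

end

/-! Let `U` have law `ν` (up to total mass) and let `B` be an independent Beta(m/2, j) variable.
Sonine's integral (`besselKernel_add`) writes the kernel of dimension m + 2j at s as the mean of the
kernel of dimension m at s√B. Hence the law of U√B represents f in dimension m, and by uniqueness of
the Schoenberg measure it is ν_m. Conditioning on U and substituting b = x²/u² yields the density
p_m (`map_mul_sqrt_restrict_Ioi`).

Uniqueness comes from integrating the Bessel transform against r^(2a-1) exp(-c r²): Weber's integral
turns it into the integral of exp(-t²/(4c)). At c = 1/(4n) these are the moments of the image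
measure under t ↦ exp(-t²), which lives on [0,1] and is determined by its moments.

For regularity, p_m(x) is a constant times ∫_{u>x} P(x/u) u⁻¹ ν(du) with P(t) = t^(m-1)
(1-t²)^(j-1). Differentiation replaces P by P' and adds a factor 1/u; no boundary term appears at u
= x while the current polynomial vanishes at 1 (`tailTransform_sub_eq_integral`). As P has a zero of
order j-1 at 1, this works j-1 times. The last kernel may jump at u = x, so the derivative of order
j-1 is only controlled where ν has no atom.

For size, x < u gives x^k |P^(k)(x/u)| u^(-k-1) ≤ C/u, so x^k p_m^(k) is dominated by ∫_{u>x}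
ν(du)/u. This is at most I in (iii), and is the dual Hardy operator applied to the density of ν in
(ii), bounded on L^p for finite p. Bounding the kernel by C x^(-k-1) instead leaves the tail mass of
ν as a factor, whence the little-o. -/

/-! ### The normalized Bessel kernel -/

/-- The kernel `∑ i, Γ(a) / (i! Γ(i + a)) (-s²/4)^i` with a real parameter `a`;
`a = n / 2` gives the Schoenberg kernel of dimension `n`. -/
noncomputable def besselKernel (a s : ℝ) : ℝ :=
  ∑' i : ℕ, Real.Gamma a / (i.factorial * Real.Gamma (i + a)) * (-(s ^ 2) / 4) ^ i

theorem schoenbergKernel_eq_besselKernel (n : ℕ) (s : ℝ) :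
    schoenbergKernel n s = besselKernel (n / 2) s := rfl

/-- Each step of the recursion for Γ multiplies by i + a ≥ a. This lets the exponential series
dominate the Bessel series. -/
theorem pow_mul_Gamma_le {a : ℝ} (ha : 0 < a) (i : ℕ) :
    a ^ i * Real.Gamma a ≤ Real.Gamma (i + a) := by
  induction i with
  | zero => simp
  | succ i ih =>
    have h : Real.Gamma ((i + 1 : ℕ) + a) = (i + a) * Real.Gamma (i + a) := by
      rw [← Real.Gamma_add_one (by positivity)]; push_cast; ring_nf
    rw [h, pow_succ]
    have h0 : 0 ≤ a ^ i * Real.Gamma a := mul_nonneg (by positivity) (Real.Gamma_pos_of_pos ha).le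
    nlinarith [Nat.cast_nonneg (α := ℝ) i]

theorem besselCoeff_pos {a : ℝ} (ha : 0 < a) (i : ℕ) :
    0 < Real.Gamma a / (i.factorial * Real.Gamma (i + a)) := by
  have := Real.Gamma_pos_of_pos ha
  have : 0 < Real.Gamma (i + a) := Real.Gamma_pos_of_pos (by positivity)
  positivity

theorem summable_besselCoeff_mul_pow {a : ℝ} (ha : 0 < a) (z : ℝ) :
    Summable fun i : ℕ => Real.Gamma a / (i.factorial * Real.Gamma (i + a)) * z ^ i := by
  refine Summable.of_norm_bounded (Real.summable_pow_div_factorial (|z| / a)) fun i => ?_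
  have h1 := Real.Gamma_pos_of_pos ha
  have h2 : 0 < Real.Gamma (i + a) := Real.Gamma_pos_of_pos (by positivity)
  rw [norm_mul, norm_pow, Real.norm_of_nonneg (besselCoeff_pos ha i).le, Real.norm_eq_abs, div_pow,
    div_mul_eq_mul_div, div_div, div_le_div_iff₀ (by positivity) (by positivity)]
  have := mul_le_mul_of_nonneg_left (pow_mul_Gamma_le ha i)
    (by positivity : 0 ≤ |z| ^ i * i.factorial)
  linarith

theorem hasSum_besselKernel {a : ℝ} (ha : 0 < a) (s : ℝ) :
    HasSum (fun i : ℕ => Real.Gamma a / (i.factorial * Real.Gamma (i + a)) * (-(s ^ 2) / 4) ^ i)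
      (besselKernel a s) :=
  (summable_besselCoeff_mul_pow ha _).hasSum

theorem besselKernel_zero_right {a : ℝ} (ha : 0 < a) : besselKernel a 0 = 1 := by
  have h1 := Real.Gamma_pos_of_pos ha
  unfold besselKernel
  rw [tsum_eq_single 0 (fun i hi => by simp [hi])]
  simp [h1.ne']

/-- Duplication formula at half-integers; it identifies the kernel with a = 1/2 as the cosine. -/
theorem Gamma_nat_add_half_mul_factorial (i : ℕ) :
    Real.Gamma (i + 1 / 2) * i.factorial * 4 ^ i = (2 * i).factorial * Real.Gamma (1 / 2) := by
  induction i with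
  | zero => simp
  | succ i ih =>
    have h : Real.Gamma ((i + 1 : ℕ) + 1 / 2) = (i + 1 / 2) * Real.Gamma (i + 1 / 2) := by
      rw [← Real.Gamma_add_one (by positivity)]; push_cast; ring_nf
    rw [h, show 2 * (i + 1) = 2 * i + 1 + 1 by ring, Nat.factorial_succ, Nat.factorial_succ,
      Nat.factorial_succ, pow_succ]
    push_cast
    linear_combination (4 * (i + 1 / 2) * (i + 1) : ℝ) * ih

theorem besselKernel_half (s : ℝ) : besselKernel (1 / 2) s = Real.cos s := by
  rw [Real.cos_eq_tsum]
  refine tsum_congr fun i => ?_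
  have h := Gamma_nat_add_half_mul_factorial i
  have h2 : 0 < Real.Gamma (i + 1 / 2) := Real.Gamma_pos_of_pos (by positivity)
  have h3 : (0 : ℝ) < (2 * i).factorial := by positivity
  rw [div_pow, neg_pow, ← pow_mul, div_mul_div_comm, div_eq_div_iff (by positivity) (by positivity)]
  linear_combination (-(-1) ^ i * s ^ (2 * i) : ℝ) * h

/-! ### Beta measures -/

theorem beta_half_pos {m j : ℕ} (hm : 1 ≤ m) (hj : 1 ≤ j) :
    0 < ProbabilityTheory.beta (m / 2 : ℝ) j := by
  have : (0 : ℝ) < m := by exact_mod_cast hm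
  exact ProbabilityTheory.beta_pos (by positivity) (by exact_mod_cast hj)

theorem measurable_betaPDF (a b : ℝ) : Measurable (ProbabilityTheory.betaPDF a b) :=
  (ProbabilityTheory.measurable_betaPDFReal a b).ennreal_ofReal

theorem ae_mem_Ioo_betaMeasure (a b : ℝ) :
    ∀ᵐ x ∂ProbabilityTheory.betaMeasure a b, x ∈ Ioo (0 : ℝ) 1 := by
  rw [ProbabilityTheory.betaMeasure, ae_withDensity_iff
    (measurable_betaPDF a b)]
  refine ae_of_all _ fun x hx => ?_
  by_contra h
  apply hx
  simp [ProbabilityTheory.betaPDF_eq, show ¬ (0 < x ∧ x < 1) from h]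

/-- Multiplying the Beta(a, b) density by x^i gives a multiple of the Beta(a + i, b) density, which
has mass one. -/
theorem integral_pow_betaMeasure {a b : ℝ} (ha : 0 < a) (hb : 0 < b) (i : ℕ) :
    ∫ x, x ^ i ∂ProbabilityTheory.betaMeasure a b =
      ProbabilityTheory.beta (a + i) b / ProbabilityTheory.beta a b := by
  have hai : 0 < a + i := by positivity
  have h1 := ProbabilityTheory.beta_pos ha hb
  have h2 := ProbabilityTheory.beta_pos hai hb
  rw [integral_eq_lintegral_of_nonneg_ae]
  · have h : ∫⁻ x, ENNReal.ofReal (x ^ i) ∂ProbabilityTheory.betaMeasure a b =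
        ENNReal.ofReal (ProbabilityTheory.beta (a + i) b / ProbabilityTheory.beta a b) := by
      rw [ProbabilityTheory.betaMeasure, lintegral_withDensity_eq_lintegral_mul _
        (measurable_betaPDF a b) (by fun_prop)]
      rw [← mul_one (ENNReal.ofReal (ProbabilityTheory.beta (a + i) b / _)),
        ← ProbabilityTheory.lintegral_betaPDF_eq_one hai hb, ← lintegral_const_mul _
        (measurable_betaPDF _ b)]
      refine lintegral_congr fun x => ?_
      simp only [Pi.mul_apply, ProbabilityTheory.betaPDF_eq]
      split_ifs with hx
      · have hx1 : 0 < 1 - x := by linarith [hx.2]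
        have hx0 := hx.1
        rw [← ENNReal.ofReal_mul (by positivity), ← ENNReal.ofReal_mul (by positivity)]
        congr 1
        rw [show a + i - 1 = a - 1 + i by ring, Real.rpow_add_natCast hx0.ne']
        field_simp
      · simp
    rw [h, ENNReal.toReal_ofReal (by positivity)]
  · filter_upwards [ae_mem_Ioo_betaMeasure a b] with x hx
    exact pow_nonneg hx.1.le i
  · exact (by fun_prop : Measurable fun x : ℝ => x ^ i).aestronglyMeasurable

theorem integrable_pow_betaMeasure {a b : ℝ} (ha : 0 < a) (hb : 0 < b) (i : ℕ) :
    Integrable (fun x : ℝ => x ^ i) (ProbabilityTheory.betaMeasure a b) := by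
  have := ProbabilityTheory.isProbabilityMeasureBeta ha hb
  refine Integrable.of_bound (by fun_prop : Measurable fun x : ℝ => x ^ i).aestronglyMeasurable 1 ?_
  filter_upwards [ae_mem_Ioo_betaMeasure a b] with x hx
  rw [norm_pow, Real.norm_of_nonneg hx.1.le]
  exact pow_le_one₀ hx.1.le hx.2.le

/-- Sonine's first finite integral, in probabilistic form. -/
theorem besselKernel_add {a b : ℝ} (ha : 0 < a) (hb : 0 < b) (s : ℝ) :
    besselKernel (a + b) s =
      ∫ x, besselKernel a (s * √x) ∂ProbabilityTheory.betaMeasure a b := by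
  set c : ℕ → ℝ := fun i => Real.Gamma a / (i.factorial * Real.Gamma (i + a)) with hc
  have hint : ∀ i : ℕ, Integrable (fun x : ℝ => c i * (-(s ^ 2) / 4) ^ i * x ^ i)
      (ProbabilityTheory.betaMeasure a b) :=
    fun i => (integrable_pow_betaMeasure ha hb i).const_mul _
  have hterm : ∀ i : ℕ, ∫ x, c i * (-(s ^ 2) / 4) ^ i * x ^ i ∂ProbabilityTheory.betaMeasure a b =
      Real.Gamma (a + b) / (i.factorial * Real.Gamma (i + (a + b))) * (-(s ^ 2) / 4) ^ i := by
    intro i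
    have h1 := Real.Gamma_pos_of_pos ha
    have h2 := Real.Gamma_pos_of_pos hb
    have h3 := Real.Gamma_pos_of_pos (add_pos ha hb)
    have h4 : 0 < Real.Gamma (i + a) := Real.Gamma_pos_of_pos (by positivity)
    have h5 : 0 < Real.Gamma (i + (a + b)) := Real.Gamma_pos_of_pos (by positivity)
    rw [integral_const_mul, integral_pow_betaMeasure ha hb, ProbabilityTheory.beta,
      ProbabilityTheory.beta, add_comm a (i : ℝ), add_assoc, hc]
    field_simp
  have hnorm : ∀ i : ℕ, ∫ x, ‖c i * (-(s ^ 2) / 4) ^ i * x ^ i‖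
        ∂ProbabilityTheory.betaMeasure a b =
      Real.Gamma (a + b) / (i.factorial * Real.Gamma (i + (a + b))) * (s ^ 2 / 4) ^ i := by
    intro i
    -- Each term has constant sign on (0,1), so the norm passes outside the integral; the norms then
    -- sum to a Bessel series at s²/4 in place of -s²/4.
    have h6 : ∫ x, ‖c i * (-(s ^ 2) / 4) ^ i * x ^ i‖ ∂ProbabilityTheory.betaMeasure a b =
        ‖∫ x, c i * (-(s ^ 2) / 4) ^ i * x ^ i ∂ProbabilityTheory.betaMeasure a b‖ := by
      rw [integral_const_mul, norm_mul, Real.norm_of_nonneg (integral_nonneg_of_ae _),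
        ← integral_const_mul]
      · refine integral_congr_ae ?_
        filter_upwards [ae_mem_Ioo_betaMeasure a b] with x hx
        rw [norm_mul, Real.norm_of_nonneg (pow_nonneg hx.1.le i)]
      · filter_upwards [ae_mem_Ioo_betaMeasure a b] with x hx
        exact pow_nonneg hx.1.le i
    rw [h6, hterm, norm_mul, norm_pow, neg_div, norm_neg,
      Real.norm_of_nonneg (besselCoeff_pos (add_pos ha hb) i).le,
      Real.norm_of_nonneg (by positivity : 0 ≤ s ^ 2 / 4)]
  have key := hasSum_integral_of_summable_integral_norm hint
    (by simp_rw [hnorm]; exact summable_besselCoeff_mul_pow (add_pos ha hb) _)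
  simp_rw [hterm] at key
  rw [(hasSum_besselKernel (add_pos ha hb) s).unique key]
  refine integral_congr_ae ?_
  filter_upwards [ae_mem_Ioo_betaMeasure a b] with x hx
  refine tsum_congr fun i => ?_
  rw [mul_pow s, Real.sq_sqrt hx.1.le, mul_assoc, ← mul_pow]
  congr 2
  ring

/-- For a > 1/2, Sonine's integral started at 1/2 exhibits the kernel as a Beta average of cosines,
from which both properties are inherited. -/
theorem continuous_besselKernel_and_abs_le_one {a : ℝ} (ha : 1 / 2 ≤ a) :
    Continuous (besselKernel a) ∧ ∀ s, |besselKernel a s| ≤ 1 := by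
  rcases ha.eq_or_lt with rfl | h
  · rw [show besselKernel (1 / 2) = Real.cos from funext besselKernel_half]
    exact ⟨Real.continuous_cos, Real.abs_cos_le_one⟩
  · have hb : 0 < a - 1 / 2 := by linarith
    have := ProbabilityTheory.isProbabilityMeasureBeta (by norm_num : (0 : ℝ) < 1 / 2) hb
    have hk : besselKernel a = fun s => ∫ x, Real.cos (s * √x)
        ∂ProbabilityTheory.betaMeasure (1 / 2) (a - 1 / 2) := by
      funext s
      rw [show a = 1 / 2 + (a - 1 / 2) by ring, besselKernel_add (by norm_num) hb]
      simp_rw [besselKernel_half]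
      ring_nf
    rw [hk]
    refine ⟨continuous_of_dominated (bound := fun _ => 1) (fun s => ?_) (fun s => ?_)
      (integrable_const _) ?_, fun s => ?_⟩
    · exact (by fun_prop : Continuous fun x : ℝ => Real.cos (s * √x)).aestronglyMeasurable
    · exact ae_of_all _ fun x => Real.abs_cos_le_one _
    · exact ae_of_all _ fun x => by fun_prop
    · rw [← Real.norm_eq_abs]
      refine (norm_integral_le_of_norm_le_const (C := 1)
        (ae_of_all _ fun x => Real.abs_cos_le_one _)).trans ?_
      rw [one_mul, probReal_univ]

theorem continuous_besselKernel {a : ℝ} (ha : 1 / 2 ≤ a) : Continuous (besselKernel a) :=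
  (continuous_besselKernel_and_abs_le_one ha).1

theorem abs_besselKernel_le_one {a : ℝ} (ha : 1 / 2 ≤ a) (s : ℝ) : |besselKernel a s| ≤ 1 :=
  (continuous_besselKernel_and_abs_le_one ha).2 s

/-! ### Uniqueness of the Schoenberg measure -/

theorem integral_rpow_mul_exp_neg_mul_sq_add_nat {a c : ℝ} (ha : 0 < a) (hc : 0 < c) (i : ℕ) :
    ∫ r in Ioi (0 : ℝ), r ^ (2 * i) * (r ^ (2 * a - 1) * Real.exp (-c * r ^ 2)) =
      c ^ (-(i + a)) / 2 * Real.Gamma (i + a) := by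
  have h := integral_rpow_mul_exp_neg_mul_rpow (p := 2) (q := 2 * i + 2 * a - 1) (b := c)
    (by norm_num) (by have : (0:ℝ) ≤ i := by positivity
                      linarith) hc
  rw [show (2 * (i : ℝ) + 2 * a - 1 + 1) / 2 = i + a by ring,
    show -(2 * (i : ℝ) + 2 * a - 1 + 1) / 2 = -(i + a) by ring] at h
  rw [div_eq_mul_one_div, ← h]
  refine setIntegral_congr_fun measurableSet_Ioi fun r hr => ?_
  have hr : 0 < r := hr
  rw [show 2 * (i : ℝ) + 2 * a - 1 = 2 * a - 1 + (2 * i : ℕ) by push_cast; ring,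
    Real.rpow_add_natCast hr.ne', Real.rpow_two]
  ring

theorem integrable_rpow_mul_exp_neg_mul_sq_add_nat {a c : ℝ} (ha : 0 < a) (hc : 0 < c) (i : ℕ) :
    IntegrableOn (fun r : ℝ => r ^ (2 * i) * (r ^ (2 * a - 1) * Real.exp (-c * r ^ 2)))
      (Ioi 0) := by
  have h := integrableOn_rpow_mul_exp_neg_mul_sq hc (s := 2 * i + 2 * a - 1)
    (by have : (0:ℝ) ≤ i := by positivity
        linarith)
  refine h.congr_fun (fun r hr => ?_) measurableSet_Ioi
  have hr : 0 < r := hr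
  simp only
  rw [show 2 * (i : ℝ) + 2 * a - 1 = 2 * a - 1 + (2 * i : ℕ) by push_cast; ring,
    Real.rpow_add_natCast hr.ne']
  ring

/-- Weber's first exponential integral. -/
theorem integral_besselKernel_mul_gaussian {a c : ℝ} (ha : 0 < a) (hc : 0 < c) (t : ℝ) :
    ∫ r in Ioi (0 : ℝ), besselKernel a (r * t) * (r ^ (2 * a - 1) * Real.exp (-c * r ^ 2)) =
      Real.Gamma a / 2 * c ^ (-a) * Real.exp (-(t ^ 2 / (4 * c))) := by
  set k : ℕ → ℝ := fun i => Real.Gamma a / (i.factorial * Real.Gamma (i + a)) with hk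
  set F : ℕ → ℝ → ℝ := fun i r =>
    k i * (-(t ^ 2) / 4) ^ i * (r ^ (2 * i) * (r ^ (2 * a - 1) * Real.exp (-c * r ^ 2))) with hF
  have hint : ∀ i, IntegrableOn (F i) (Ioi 0) := fun i =>
    (integrable_rpow_mul_exp_neg_mul_sq_add_nat ha hc i).const_mul _
  -- Γ(i + a) cancels and an exponential series remains. The free z serves both signs: -t²/4 for the
  -- value, t²/4 for absolute convergence.
  have hval : ∀ i (z : ℝ), k i * z ^ i * (c ^ (-(i + a)) / 2 * Real.Gamma (i + a)) =
      Real.Gamma a / 2 * c ^ (-a) * ((z / c) ^ i / i.factorial) := by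
    intro i z
    have h4 : 0 < Real.Gamma (i + a) := Real.Gamma_pos_of_pos (by positivity)
    rw [hk, neg_add, Real.rpow_add hc, Real.rpow_neg hc.le, Real.rpow_natCast, div_pow]
    field_simp
  have hterm : ∀ i, ∫ r in Ioi (0 : ℝ), F i r =
      Real.Gamma a / 2 * c ^ (-a) * ((-(t ^ 2) / 4 / c) ^ i / i.factorial) := by
    intro i
    rw [hF, integral_const_mul, integral_rpow_mul_exp_neg_mul_sq_add_nat ha hc, hval]
  have hnorm : ∀ i, ∫ r in Ioi (0 : ℝ), ‖F i r‖ =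
      Real.Gamma a / 2 * c ^ (-a) * (((t ^ 2) / 4 / c) ^ i / i.factorial) := by
    intro i
    rw [← hval, ← integral_rpow_mul_exp_neg_mul_sq_add_nat ha hc, ← integral_const_mul]
    refine setIntegral_congr_fun measurableSet_Ioi fun r hr => ?_
    have hr : 0 < r := hr
    simp only [hF]
    rw [norm_mul, norm_mul, norm_pow, neg_div, norm_neg,
      Real.norm_of_nonneg (besselCoeff_pos ha i).le, Real.norm_of_nonneg (by positivity),
      Real.norm_of_nonneg (by positivity)]
  have key := hasSum_integral_of_summable_integral_norm hint (by
    simp_rw [hnorm]; exact (Real.summable_pow_div_factorial _).mul_left _)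
  simp_rw [hterm] at key
  have hexp : HasSum (fun i : ℕ => Real.Gamma a / 2 * c ^ (-a) *
      ((-(t ^ 2) / 4 / c) ^ i / i.factorial))
      (Real.Gamma a / 2 * c ^ (-a) * Real.exp (-(t ^ 2) / 4 / c)) := by
    have h := NormedSpace.expSeries_div_hasSum_exp (-(t ^ 2) / 4 / c)
    rw [← Real.exp_eq_exp_ℝ] at h
    exact h.mul_left _
  rw [show -(t ^ 2 / (4 * c)) = -(t ^ 2) / 4 / c by field_simp, hexp.unique key]
  refine setIntegral_congr_fun measurableSet_Ioi fun r _ => ?_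
  simp only [hF]
  rw [besselKernel, ← tsum_mul_right]
  refine tsum_congr fun i => ?_
  rw [show -(r * t) ^ 2 / 4 = -(t ^ 2) / 4 * r ^ 2 by ring, mul_pow, pow_mul r]
  simp only [hk, mul_assoc]

/-- The Gaussian transform of a finite measure is determined by its Bessel kernel transform. -/
theorem integral_gaussian_eq_of_integral_besselKernel_eq {a : ℝ} (ha : 1 / 2 ≤ a)
    (μ : Measure ℝ) [IsFiniteMeasure μ] {c : ℝ} (hc : 0 < c) :
    ∫ r in Ioi (0 : ℝ), (∫ t, besselKernel a (r * t) ∂μ) *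
        (r ^ (2 * a - 1) * Real.exp (-c * r ^ 2)) =
      Real.Gamma a / 2 * c ^ (-a) * ∫ t, Real.exp (-(t ^ 2 / (4 * c))) ∂μ := by
  have ha0 : 0 < a := by linarith
  simp_rw [← integral_mul_const]
  rw [integral_integral_swap]
  · simp_rw [integral_besselKernel_mul_gaussian ha0 hc]
    rw [integral_const_mul]
  · have hg := integrable_rpow_mul_exp_neg_mul_sq_add_nat ha0 hc 0
    simp only [mul_zero, pow_zero, one_mul] at hg
    have hg2 : Integrable (fun z : ℝ × ℝ => z.1 ^ (2 * a - 1) * Real.exp (-c * z.1 ^ 2))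
        ((volume.restrict (Ioi 0)).prod μ) := by
      simpa using hg.mul_prod (integrable_const (μ := μ) (1 : ℝ))
    refine hg2.bdd_mul (c := 1) ?_ (ae_of_all _ fun z => abs_besselKernel_le_one ha _)
    exact ((continuous_besselKernel ha).comp
      (continuous_fst.mul continuous_snd)).aestronglyMeasurable

/-- On [-1,1] the exponential series is dominated termwise by |s|^n / n!, so it may be integrated
term by term. -/
theorem charFun_eq_tsum_of_ae_abs_le {μ : Measure ℝ} [IsFiniteMeasure μ]
    (hμ : ∀ᵐ x ∂μ, |x| ≤ 1) (s : ℝ) :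
    charFun μ s = ∑' n : ℕ, (s * Complex.I) ^ n / n.factorial * ((∫ x, x ^ n ∂μ : ℝ) : ℂ) := by
  have hmeas : ∀ n : ℕ, AEStronglyMeasurable (fun x : ℝ => (x : ℂ) ^ n) μ := fun n =>
    (by fun_prop : Continuous fun x : ℝ => (x : ℂ) ^ n).aestronglyMeasurable
  have hb : ∀ n : ℕ, ∀ᵐ x : ℝ ∂μ, ‖(x : ℂ) ^ n‖ ≤ 1 := by
    intro n
    filter_upwards [hμ] with x hx
    rw [norm_pow, Complex.norm_real]
    exact pow_le_one₀ (norm_nonneg _) hx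
  have hint : ∀ n : ℕ, Integrable (fun x : ℝ => (x : ℂ) ^ n) μ := fun n =>
    Integrable.of_bound (hmeas n) 1 (hb n)
  have key := integral_tsum_of_summable_integral_norm
    (F := fun n (x : ℝ) => (s * Complex.I) ^ n / n.factorial * (x : ℂ) ^ n) (μ := μ)
    (fun n => (hint n).const_mul _) (by
      refine Summable.of_nonneg_of_le (fun n => integral_nonneg fun x => norm_nonneg _)
        (fun n => ?_) ((Real.summable_pow_div_factorial |s|).mul_right (μ.real univ))
      have : ∀ x : ℝ, ‖(s * Complex.I) ^ n / n.factorial * (x : ℂ) ^ n‖ =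
          |s| ^ n / n.factorial * ‖(x : ℂ) ^ n‖ := by
        intro x
        simp
      simp_rw [this]
      rw [integral_const_mul]
      gcongr
      refine (integral_mono_ae (hint n).norm (integrable_const 1) (hb n)).trans ?_
      simp)
  rw [charFun_apply_real]
  have hl : ∀ n : ℕ, ∫ x : ℝ, (s * Complex.I) ^ n / n.factorial * (x : ℂ) ^ n ∂μ =
      (s * Complex.I) ^ n / n.factorial * ((∫ x, x ^ n ∂μ : ℝ) : ℂ) := by
    intro n
    rw [integral_const_mul, ← integral_complex_ofReal]
    simp
  simp_rw [hl] at key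
  rw [key]
  refine integral_congr_ae (ae_of_all _ fun x => ?_)
  have h := NormedSpace.expSeries_div_hasSum_exp (s * x * Complex.I)
  rw [← Complex.exp_eq_exp_ℂ] at h
  simp only [← h.tsum_eq]
  refine tsum_congr fun n => ?_
  rw [show (s * x * Complex.I : ℂ) = (s * Complex.I) * x by ring, mul_pow]
  ring

theorem MeasureTheory.Measure.ext_of_integral_pow_eq {μ ν : Measure ℝ} [IsFiniteMeasure μ] [IsFiniteMeasure ν]
    (hμ : ∀ᵐ x ∂μ, |x| ≤ 1) (hν : ∀ᵐ x ∂ν, |x| ≤ 1)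
    (h : ∀ n : ℕ, ∫ x, x ^ n ∂μ = ∫ x, x ^ n ∂ν) : μ = ν := by
  refine Measure.ext_of_charFun (funext fun s => ?_)
  rw [charFun_eq_tsum_of_ae_abs_le hμ, charFun_eq_tsum_of_ae_abs_le hν]
  simp_rw [h]

/-- The change of variable t ↦ exp(-t²) is injective on [0,∞) with inverse √(-log x), so no
information is lost in passing to a bounded support. -/
theorem MeasureTheory.Measure.map_exp_neg_sq_map_sqrt_neg_log {μ : Measure ℝ} (hμ : μ (Iio 0) = 0) :
    (μ.map fun t => Real.exp (-t ^ 2)).map (fun x => √(-Real.log x)) = μ := by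
  rw [Measure.map_map (by fun_prop) (by fun_prop)]
  conv_rhs => rw [← Measure.map_id (μ := μ)]
  refine Measure.map_congr ?_
  have : ∀ᵐ t ∂μ, t ∉ Iio (0 : ℝ) := measure_eq_zero_iff_ae_notMem.1 hμ
  filter_upwards [this] with t ht
  simp [Real.sqrt_sq (not_lt.1 ht)]

/-- Uniqueness of the measure in the Laplace transform of `t²`. -/
theorem MeasureTheory.Measure.ext_of_integral_exp_neg_mul_sq_eq {μ ν : Measure ℝ} [IsFiniteMeasure μ]
    [IsFiniteMeasure ν] (hμ : μ (Iio 0) = 0) (hν : ν (Iio 0) = 0)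
    (h : ∀ n : ℕ, ∫ t, Real.exp (-(n * t ^ 2)) ∂μ = ∫ t, Real.exp (-(n * t ^ 2)) ∂ν) : μ = ν := by
  rw [← Measure.map_exp_neg_sq_map_sqrt_neg_log hμ, ← Measure.map_exp_neg_sq_map_sqrt_neg_log hν]
  congr 1
  have hb : ∀ κ : Measure ℝ, ∀ᵐ x ∂(κ.map fun t => Real.exp (-t ^ 2)), |x| ≤ 1 := by
    intro κ
    rw [ae_map_iff (by fun_prop) (measurableSet_le (by fun_prop) (by fun_prop))]
    refine ae_of_all _ fun t => ?_
    rw [abs_of_pos (Real.exp_pos _), Real.exp_le_one_iff]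
    nlinarith [sq_nonneg t]
  refine Measure.ext_of_integral_pow_eq (hb μ) (hb ν) fun n => ?_
  have hm : ∀ κ : Measure ℝ, ∫ x, x ^ n ∂(κ.map fun t => Real.exp (-t ^ 2)) =
      ∫ t, Real.exp (-(n * t ^ 2)) ∂κ := by
    intro κ
    rw [integral_map (by fun_prop) (by fun_prop)]
    refine integral_congr_ae (ae_of_all _ fun t => ?_)
    simp only
    rw [← Real.exp_nat_mul]
    ring_nf
  rw [hm, hm, h]

theorem MeasureTheory.Measure.ext_of_integral_besselKernel_eq {a : ℝ} (ha : 1 / 2 ≤ a) {μ ν : Measure ℝ}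
    [IsFiniteMeasure μ] [IsFiniteMeasure ν] (hμ : μ (Iio 0) = 0) (hν : ν (Iio 0) = 0)
    (h : ∀ r : ℝ, 0 ≤ r → ∫ t, besselKernel a (r * t) ∂μ = ∫ t, besselKernel a (r * t) ∂ν) :
    μ = ν := by
  have ha0 : 0 < a := by linarith
  refine Measure.ext_of_integral_exp_neg_mul_sq_eq hμ hν fun n => ?_
  -- The zeroth moment is the total mass, read off at r = 0. For n > 0 the choice c = 1/(4n) makes
  -- t²/(4c) equal to n t².
  rcases n.eq_zero_or_pos with rfl | hn
  · simpa [besselKernel_zero_right ha0] using h 0 le_rfl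
  · have hn' : (0 : ℝ) < n := by exact_mod_cast hn
    have hc : 0 < 1 / (4 * (n : ℝ)) := by positivity
    have e : ∀ t : ℝ, t ^ 2 / (4 * (1 / (4 * (n : ℝ)))) = n * t ^ 2 := fun t => by field_simp
    have h1 := integral_gaussian_eq_of_integral_besselKernel_eq ha μ hc
    have h2 := integral_gaussian_eq_of_integral_besselKernel_eq ha ν hc
    rw [setIntegral_congr_fun (g := fun r : ℝ => (∫ t, besselKernel a (r * t) ∂ν) *
        (r ^ (2 * a - 1) * Real.exp (-(1 / (4 * (n : ℝ))) * r ^ 2))) measurableSet_Ioi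
        (fun r hr => by simp only; rw [h r (le_of_lt hr)]), h2] at h1
    simp_rw [e] at h1
    have hG := Real.Gamma_pos_of_pos ha0
    exact (mul_left_cancel₀ (by positivity) h1).symm

/-! ### The transition formula -/

theorem image_sq_div_sq_Ioo {u : ℝ} (hu : 0 < u) :
    (fun x : ℝ => x ^ 2 / u ^ 2) '' Ioo 0 u = Ioo 0 1 := by
  ext b
  constructor
  · rintro ⟨x, hx, rfl⟩
    have hx0 := hx.1
    refine ⟨by positivity, ?_⟩
    rw [div_lt_one (by positivity)]
    exact pow_lt_pow_left₀ hx.2 hx.1.le two_ne_zero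
  · intro hb
    refine ⟨u * √b, ⟨mul_pos hu (Real.sqrt_pos.2 hb.1), ?_⟩, ?_⟩
    · have : √b < 1 := by rw [Real.sqrt_lt' one_pos]; simpa using hb.2
      nlinarith
    · simp only [mul_pow, Real.sq_sqrt hb.1.le]
      field_simp

/-- The substitution b = x²/u², with Jacobian 2x/u², gives the conditional density of U√B given U =
u. -/
theorem lintegral_mul_sqrt_betaMeasure (m : ℕ) {j : ℕ} (hm : 1 ≤ m) (hj : 1 ≤ j)
    {u : ℝ} (hu : 0 < u) {g : ℝ → ENNReal} (hg : Measurable g) :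
    ∫⁻ b, g (u * √b) ∂ProbabilityTheory.betaMeasure (m / 2) j =
      ∫⁻ x in Ioo 0 u, ENNReal.ofReal (2 * x ^ (m - 1) / ProbabilityTheory.beta (m / 2) j *
        ((1 - x ^ 2 / u ^ 2) ^ (j - 1) / u ^ m)) * g x := by
  have hB := beta_half_pos hm hj
  have hgm : Measurable fun b : ℝ => g (u * √b) := by fun_prop
  rw [ProbabilityTheory.betaMeasure,
    lintegral_withDensity_eq_lintegral_mul _ (measurable_betaPDF _ _) hgm]
  have h1 : ∫⁻ b, (ProbabilityTheory.betaPDF (m / 2) j * fun b => g (u * √b)) b =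
      ∫⁻ b in Ioo (0 : ℝ) 1,
        (ProbabilityTheory.betaPDF (m / 2) j * fun b => g (u * √b)) b := by
    refine (setLIntegral_eq_of_support_subset fun b hb => ?_).symm
    by_contra h
    apply hb
    simp [ProbabilityTheory.betaPDF_eq, show ¬ (0 < b ∧ b < 1) from h]
  rw [h1, ← image_sq_div_sq_Ioo hu,
    lintegral_image_eq_lintegral_abs_deriv_mul measurableSet_Ioo
      (f' := fun x => 2 * x / u ^ 2)]
  · refine setLIntegral_congr_fun measurableSet_Ioo fun x hx => ?_
    have hx0 := hx.1
    have hxu : x ^ 2 / u ^ 2 < 1 := by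
      rw [div_lt_one (by positivity)]
      exact pow_lt_pow_left₀ hx.2 hx.1.le two_ne_zero
    have h0 : 0 < x ^ 2 / u ^ 2 := by positivity
    simp only [Pi.mul_apply]
    rw [ProbabilityTheory.betaPDF_of_pos_lt_one h0 hxu, ← mul_assoc,
      ← ENNReal.ofReal_mul (abs_nonneg _), abs_of_pos (by positivity)]
    have hs : u * √(x ^ 2 / u ^ 2) = x := by
      rw [← div_pow, Real.sqrt_sq (by positivity)]
      field_simp
    rw [hs]
    congr 2
    obtain ⟨k, rfl⟩ : ∃ k, j = k + 1 := ⟨j - 1, by omega⟩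
    obtain ⟨l, rfl⟩ : ∃ l, m = l + 1 := ⟨m - 1, by omega⟩
    -- The power of x/u is m - 2 = l - 1, possibly negative; the split-off inverse cancels against
    -- the Jacobian.
    have e1 : (x ^ 2 / u ^ 2) ^ (((l + 1 : ℕ) : ℝ) / 2 - 1) = (x / u) ^ l * (x / u)⁻¹ := by
      rw [← div_pow, ← Real.rpow_natCast (x / u) 2, ← Real.rpow_mul (by positivity),
        ← Real.rpow_natCast (x / u) l, ← Real.rpow_neg_one, ← Real.rpow_add (by positivity)]
      congr 1
      push_cast
      ring
    have e2 : (1 - x ^ 2 / u ^ 2) ^ (((k + 1 : ℕ) : ℝ) - 1) = (1 - x ^ 2 / u ^ 2) ^ k := by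
      rw [show ((k + 1 : ℕ) : ℝ) - 1 = (k : ℝ) by push_cast; ring, Real.rpow_natCast]
    rw [e1, e2]
    simp only [Nat.add_sub_cancel]
    rw [div_pow x u l, pow_succ u l]
    field_simp
  · intro x _
    exact ((by simpa using (hasDerivAt_pow 2 x).div_const (u ^ 2) :
      HasDerivAt (fun x : ℝ => x ^ 2 / u ^ 2) (2 * x / u ^ 2) x)).hasDerivWithinAt
  · intro x hx y hy hxy
    simp only at hxy
    rw [div_left_inj' (by positivity)] at hxy
    exact (pow_left_inj₀ hx.1.le hy.1.le two_ne_zero).1 hxy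

theorem norm_transition_integrand_le {m k : ℕ} {x u : ℝ} (hx : 0 < x) (hu : x < u) :
    ‖(1 - x ^ 2 / u ^ 2) ^ k / u ^ m‖ ≤ 1 / x ^ m := by
  have hu0 : 0 < u := hx.trans hu
  have h1 : x ^ 2 / u ^ 2 ≤ 1 := by
    rw [div_le_one (by positivity)]
    exact pow_le_pow_left₀ hx.le hu.le 2
  have h0 : 0 ≤ x ^ 2 / u ^ 2 := by positivity
  rw [norm_div, norm_pow, norm_pow, Real.norm_of_nonneg (by linarith), Real.norm_of_nonneg hu0.le]
  exact div_le_div₀ zero_le_one (pow_le_one₀ (by linarith) (by linarith)) (by positivity)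
    (pow_le_pow_left₀ hx.le hu.le m)

theorem ofReal_transitionDensity {m j : ℕ} (hm : 1 ≤ m) (hj : 1 ≤ j) (ν : Measure ℝ)
    [IsFiniteMeasure ν] {x : ℝ} (hx : 0 < x) :
    ENNReal.ofReal (transitionDensity m j ν x) =
      ∫⁻ u in Ioi x, ENNReal.ofReal (2 * x ^ (m - 1) / ProbabilityTheory.beta (m / 2) j *
        ((1 - x ^ 2 / u ^ 2) ^ (j - 1) / u ^ m)) ∂ν := by
  have hB := beta_half_pos hm hj
  rw [transitionDensity, ← integral_const_mul, ofReal_integral_eq_lintegral_ofReal]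
  · refine Integrable.const_mul (Integrable.of_bound ?_ (1 / x ^ m) ?_) _
    · exact (by fun_prop : Measurable fun u : ℝ =>
        (1 - x ^ 2 / u ^ 2) ^ (j - 1) / u ^ m).aestronglyMeasurable
    · exact (ae_restrict_mem measurableSet_Ioi).mono fun u hu => norm_transition_integrand_le hx hu
  · refine (ae_restrict_mem measurableSet_Ioi).mono fun u hu => ?_
    have hu : x < u := hu
    have hu0 : 0 < u := hx.trans hu
    have h1 : x ^ 2 / u ^ 2 ≤ 1 := by
      rw [div_le_one (by positivity)]
      exact pow_le_pow_left₀ hx.le hu.le 2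
    have : 0 ≤ 1 - x ^ 2 / u ^ 2 := by linarith
    simp only [Pi.zero_apply]
    positivity

/-- The law of `U √B` for independent `U ∼ ν` and `B ∼ Beta(m/2, j)` has density
`transitionDensity m j ν` on the positive half-line. -/
theorem map_mul_sqrt_restrict_Ioi {m j : ℕ} (hm : 1 ≤ m) (hj : 1 ≤ j) (ν : Measure ℝ)
    [IsFiniteMeasure ν] (hν : ν (Iio 0) = 0) :
    ((ν.prod (ProbabilityTheory.betaMeasure (m / 2) j)).map
        fun z : ℝ × ℝ => z.1 * √z.2).restrict (Ioi 0) =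
      (volume.restrict (Ioi 0)).withDensity
        (fun x => ENNReal.ofReal (transitionDensity m j ν x)) := by
  have hm0 : (0 : ℝ) < m := by exact_mod_cast hm
  have hj0 : (0 : ℝ) < j := by exact_mod_cast hj
  have := ProbabilityTheory.isProbabilityMeasureBeta (by positivity : (0 : ℝ) < m / 2) hj0
  set D : ℝ → ℝ → ENNReal := fun x u => ENNReal.ofReal
    (2 * x ^ (m - 1) / ProbabilityTheory.beta (m / 2) j *
        ((1 - x ^ 2 / u ^ 2) ^ (j - 1) / u ^ m)) with hD
  have hDm : Measurable (Function.uncurry D) := by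
    rw [hD]
    exact (by fun_prop : Measurable fun z : ℝ × ℝ => ENNReal.ofReal
      (2 * z.1 ^ (m - 1) / ProbabilityTheory.beta (m / 2) j *
        ((1 - z.1 ^ 2 / z.2 ^ 2) ^ (j - 1) / z.2 ^ m)))
  ext A hA
  have hA' := hA.inter (measurableSet_Ioi (a := (0 : ℝ)))
  set g : ℝ → ENNReal := (A ∩ Ioi 0).indicator 1 with hg
  have hgm : Measurable g := measurable_one.indicator hA'
  have hmul : Measurable fun z : ℝ × ℝ => z.1 * √z.2 := by fun_prop
  have hae : ∀ᵐ u ∂ν, u ∉ Iio (0 : ℝ) := measure_eq_zero_iff_ae_notMem.1 hν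
  have hinner : ∀ u : ℝ, u ∉ Iio (0 : ℝ) →
      ∫⁻ b, g (u * √b) ∂ProbabilityTheory.betaMeasure (m / 2) j =
        ∫⁻ x in Ioi 0, (Ioi x).indicator (fun u => D x u) u * g x := by
    intro u hu
    -- An atom of ν at 0 is sent to 0, which `g` does not see.
    rcases (not_lt.1 (show ¬ u < 0 from hu)).eq_or_lt with rfl | hu
    · have h1 : ∀ b : ℝ, g (0 * √b) = 0 := by simp [hg]
      simp_rw [h1]
      rw [lintegral_zero]
      refine (setLIntegral_eq_zero measurableSet_Ioi fun x hx => ?_).symm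
      simp [le_of_lt (show (0 : ℝ) < x from hx)]
    · rw [lintegral_mul_sqrt_betaMeasure m hm hj hu hgm]
      have : Ioo 0 u = Iio u ∩ Ioi 0 := by ext; simp [and_comm]
      rw [this, ← Measure.restrict_restrict measurableSet_Iio,
        ← lintegral_indicator measurableSet_Iio]
      refine lintegral_congr fun x => ?_
      by_cases h : x < u <;> simp [h, hD]
  calc _ = ∫⁻ z, g (z.1 * √z.2) ∂(ν.prod (ProbabilityTheory.betaMeasure (m / 2) j)) := by
        rw [Measure.restrict_apply hA, ← lintegral_map hgm hmul, hg, lintegral_indicator_one hA']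
    _ = ∫⁻ u, (∫⁻ x in Ioi 0, (Ioi x).indicator (fun u => D x u) u * g x) ∂ν := by
        rw [lintegral_prod (fun z : ℝ × ℝ => g (z.1 * √z.2)) (hgm.comp hmul).aemeasurable]
        exact lintegral_congr_ae (hae.mono hinner)
    _ = ∫⁻ x in Ioi 0, ∫⁻ u, (Ioi x).indicator (fun u => D x u) u * g x ∂ν := by
        refine lintegral_lintegral_swap (Measurable.aemeasurable ?_)
        refine Measurable.mul ?_ (hgm.comp measurable_snd)
        have : MeasurableSet {z : ℝ × ℝ | z.2 < z.1} := measurableSet_lt measurable_snd measurable_fst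
        exact (hDm.comp measurable_swap).indicator this
    _ = ∫⁻ x in Ioi 0, A.indicator (fun x => ENNReal.ofReal (transitionDensity m j ν x)) x := by
        refine setLIntegral_congr_fun measurableSet_Ioi fun x hx => ?_
        have hx : 0 < x := hx
        have hDx : Measurable (D x) := hDm.of_uncurry_left
        rw [lintegral_mul_const _ (hDx.indicator measurableSet_Ioi),
          lintegral_indicator measurableSet_Ioi]
        by_cases h : x ∈ A
        · simp [hg, h, hx, ofReal_transitionDensity hm hj ν hx, hD]
        · simp [hg, h]
    _ = _ := by
        rw [withDensity_apply _ hA, ← lintegral_indicator hA]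

/-- By Sonine's integral and Fubini both sides have Bessel transform f with parameter m/2, so
uniqueness applies. -/
theorem IsSchoenbergMeasure.eq_map_mul_sqrt {m j : ℕ} (hm : 1 ≤ m) (hj : 1 ≤ j) {f : ℝ → ℝ}
    {νm ν : Measure ℝ} (hνm : IsSchoenbergMeasure m f νm)
    (hν : IsSchoenbergMeasure (m + 2 * j) f ν) :
    νm = (ν.prod (ProbabilityTheory.betaMeasure (m / 2) j)).map
      fun z : ℝ × ℝ => z.1 * √z.2 := by
  have := hνm.finite
  have := hν.finite
  have hm1 : (1 : ℝ) ≤ m := by exact_mod_cast hm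
  have hj0 : (0 : ℝ) < j := by exact_mod_cast hj
  have hm0 : (0 : ℝ) < m / 2 := by positivity
  have := ProbabilityTheory.isProbabilityMeasureBeta hm0 hj0
  have hmul : Measurable fun z : ℝ × ℝ => z.1 * √z.2 := by fun_prop
  have hhalf : (1 / 2 : ℝ) ≤ m / 2 := by linarith
  refine Measure.ext_of_integral_besselKernel_eq hhalf hνm.support ?_ fun r hr => ?_
  · rw [Measure.map_apply hmul measurableSet_Iio]
    refine measure_mono_null (t := Iio 0 ×ˢ univ) (fun z hz => ?_) (by simp [hν.support])
    have hz : z.1 * √z.2 < 0 := hz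
    simp only [mem_prod, mem_Iio, mem_univ, and_true]
    by_contra h
    exact absurd hz (not_lt.2 (mul_nonneg (not_lt.1 h) (Real.sqrt_nonneg _)))
  · have hc := continuous_besselKernel hhalf
    have h1 := hνm.repr r hr
    have h2 := hν.repr r hr
    simp_rw [schoenbergKernel_eq_besselKernel] at h1 h2
    rw [← h1, h2, integral_map hmul.aemeasurable
      (f := fun t => besselKernel (m / 2) (r * t))
      (hc.comp (continuous_const.mul continuous_id)).aestronglyMeasurable, integral_prod]
    · refine integral_congr_ae (ae_of_all _ fun u => ?_)
      simp only
      rw [show ((m + 2 * j : ℕ) : ℝ) / 2 = m / 2 + j by push_cast; ring,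
        besselKernel_add hm0 hj0]
      simp_rw [mul_assoc]
    · refine Integrable.of_bound ?_ 1 (ae_of_all _ fun z => abs_besselKernel_le_one hhalf _)
      exact (hc.measurable.comp (hmul.const_mul r)).aestronglyMeasurable

theorem IsSchoenbergMeasure.restrict_Ioi_eq_withDensity {m j : ℕ} (hm : 1 ≤ m) (hj : 1 ≤ j)
    {f : ℝ → ℝ} {νm ν : Measure ℝ} (hνm : IsSchoenbergMeasure m f νm)
    (hν : IsSchoenbergMeasure (m + 2 * j) f ν) :
    νm.restrict (Ioi 0) = (volume.restrict (Ioi 0)).withDensity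
      (fun x => ENNReal.ofReal (transitionDensity m j ν x)) := by
  have := hν.finite
  rw [hνm.eq_map_mul_sqrt hm hj hν, map_mul_sqrt_restrict_Ioi hm hj ν hν.support]

/-! ### Tail transforms with polynomial kernels -/

/-- The kernel `1_{u > x} P(x/u) u^{-k-1}`. -/
noncomputable def tailKernel (P : Polynomial ℝ) (k : ℕ) (x u : ℝ) : ℝ :=
  if x < u then P.eval (x / u) / u ^ (k + 1) else 0

/-- The transform `x ↦ ∫_{(x,∞)} P(x/u) u^{-k-1} ν(du)`. -/
noncomputable def tailTransform (ν : Measure ℝ) (P : Polynomial ℝ) (k : ℕ) (x : ℝ) : ℝ :=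
  ∫ u, tailKernel P k x u ∂ν

theorem measurable_uncurry_tailKernel (P : Polynomial ℝ) (k : ℕ) :
    Measurable (Function.uncurry (tailKernel P k)) := by
  refine Measurable.ite (measurableSet_lt measurable_fst measurable_snd) ?_ measurable_const
  exact (P.continuous.measurable.comp (measurable_fst.div measurable_snd)).div
    (measurable_snd.pow_const _)

theorem measurable_tailKernel (P : Polynomial ℝ) (k : ℕ) (x : ℝ) :
    Measurable (tailKernel P k x) :=
  (measurable_uncurry_tailKernel P k).of_uncurry_left

theorem stronglyMeasurable_tailTransform (ν : Measure ℝ) [SFinite ν] (P : Polynomial ℝ) (k : ℕ) :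
    StronglyMeasurable (tailTransform ν P k) :=
  (measurable_uncurry_tailKernel P k).stronglyMeasurable.integral_prod_right

theorem Polynomial.exists_abs_eval_le_Icc (P : Polynomial ℝ) :
    ∃ C, 0 ≤ C ∧ ∀ t ∈ Icc (0 : ℝ) 1, |P.eval t| ≤ C := by
  obtain ⟨C, hC⟩ := isCompact_Icc.exists_bound_of_continuousOn
    (s := Icc (0 : ℝ) 1) P.continuous.continuousOn
  exact ⟨C, (norm_nonneg _).trans (hC 0 (by simp)), hC⟩

theorem norm_tailKernel_le {P : Polynomial ℝ} {C : ℝ}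
    (hP : ∀ t ∈ Icc (0 : ℝ) 1, |P.eval t| ≤ C) (k : ℕ) {x u : ℝ} (hx : 0 ≤ x) (hu : x < u) :
    ‖tailKernel P k x u‖ ≤ C / u ^ (k + 1) := by
  have hu0 : 0 < u := hx.trans_lt hu
  rw [tailKernel, if_pos hu, norm_div, Real.norm_of_nonneg (pow_pos hu0 (k + 1)).le]
  gcongr
  exact hP _ ⟨by positivity, (div_le_one hu0).2 hu.le⟩

theorem norm_tailKernel_le_of_pos {P : Polynomial ℝ} {C : ℝ} (hC : 0 ≤ C)
    (hP : ∀ t ∈ Icc (0 : ℝ) 1, |P.eval t| ≤ C) (k : ℕ) {a x : ℝ} (ha : 0 < a) (hx : a ≤ x)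
    (u : ℝ) : ‖tailKernel P k x u‖ ≤ C / a ^ (k + 1) := by
  rcases lt_or_ge x u with h | h
  · refine (norm_tailKernel_le hP k (ha.le.trans hx) h).trans ?_
    gcongr
    linarith
  · rw [tailKernel, if_neg h.not_gt, norm_zero]
    positivity

theorem integrable_tailKernel (ν : Measure ℝ) [IsFiniteMeasure ν] (P : Polynomial ℝ) (k : ℕ)
    {x : ℝ} (hx : 0 < x) : Integrable (tailKernel P k x) ν := by
  obtain ⟨C, hC, hP⟩ := P.exists_abs_eval_le_Icc
  exact Integrable.of_bound (measurable_tailKernel P k x).aestronglyMeasurable (C / x ^ (k + 1))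
    (ae_of_all _ (norm_tailKernel_le_of_pos hC hP k hx le_rfl))

/-- The kernel can be discontinuous at x only for u = x, a ν-null event here; dominated convergence
does the rest. -/
theorem continuousAt_tailTransform (ν : Measure ℝ) [IsFiniteMeasure ν] (P : Polynomial ℝ) (k : ℕ)
    {x : ℝ} (hx : 0 < x) (hν : ν {x} = 0) : ContinuousAt (tailTransform ν P k) x := by
  obtain ⟨C, hC, hP⟩ := P.exists_abs_eval_le_Icc
  refine continuousAt_of_dominated (bound := fun _ => C / (x / 2) ^ (k + 1))
    (Eventually.of_forall fun y => (measurable_tailKernel P k y).aestronglyMeasurable) ?_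
    (integrable_const _) ?_
  · filter_upwards [lt_mem_nhds (half_lt_self hx)] with y hy
    exact ae_of_all _ (norm_tailKernel_le_of_pos hC hP k (by positivity) hy.le)
  · have : ∀ᵐ u ∂ν, u ∉ ({x} : Set ℝ) := measure_eq_zero_iff_ae_notMem.1 hν
    filter_upwards [this] with u hu
    rcases lt_or_gt_of_ne (show u ≠ x from hu) with h | h
    · refine (continuousAt_const (y := (0 : ℝ))).congr ?_
      filter_upwards [lt_mem_nhds h] with y hy
      rw [tailKernel, if_neg hy.not_gt]
    · have hc : ContinuousAt (fun y => P.eval (y / u) / u ^ (k + 1)) x :=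
        ((P.continuous.comp (continuous_id.div_const u)).div_const _).continuousAt
      refine hc.congr ?_
      filter_upwards [gt_mem_nhds h] with y hy
      rw [tailKernel, if_pos hy]

theorem norm_tailTransform_le_of_pos (ν : Measure ℝ) [IsFiniteMeasure ν] {P : Polynomial ℝ}
    {C : ℝ} (hP : ∀ t ∈ Icc (0 : ℝ) 1, |P.eval t| ≤ C) (k : ℕ) {x : ℝ} (hx : 0 < x) :
    ‖tailTransform ν P k x‖ ≤ C / x ^ (k + 1) * ν.real (Ioi x) := by
  have hC : 0 ≤ C := (abs_nonneg _).trans (hP 0 (by simp))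
  have h : tailTransform ν P k x = ∫ u in Ioi x, tailKernel P k x u ∂ν := by
    refine (setIntegral_eq_integral_of_forall_compl_eq_zero fun u hu => ?_).symm
    rw [tailKernel, if_neg (show ¬ x < u from hu)]
  rw [h]
  exact norm_setIntegral_le_of_norm_le_const (measure_lt_top _ _)
    fun u _ => norm_tailKernel_le_of_pos hC hP k hx le_rfl u

theorem intervalIntegrable_tailTransform (ν : Measure ℝ) [IsFiniteMeasure ν] (P : Polynomial ℝ)
    (k : ℕ) {a b : ℝ} (ha : 0 < a) (hab : a ≤ b) :
    IntervalIntegrable (tailTransform ν P k) volume a b := by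
  obtain ⟨C, hC, hP⟩ := P.exists_abs_eval_le_Icc
  rw [intervalIntegrable_iff_integrableOn_Ioc_of_le hab]
  refine Measure.integrableOn_of_bounded (M := C / a ^ (k + 1) * ν.real univ) (by simp)
    (stronglyMeasurable_tailTransform ν P k).aestronglyMeasurable ?_
  refine (ae_restrict_mem measurableSet_Ioc).mono fun x hx => ?_
  have hx0 : 0 < x := ha.trans hx.1
  refine (norm_tailTransform_le_of_pos ν hP k hx0).trans ?_
  gcongr
  · exact hx.1.le
  · exact measure_ne_top _ _
  · exact subset_univ _

/-- Vanishing of P at 1 removes the jump of the kernel at y = u, so the fundamental theorem of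
calculus holds across it. -/
theorem intervalIntegral_tailKernel_derivative {P : Polynomial ℝ} (hP : P.eval 1 = 0) (k : ℕ)
    {a b : ℝ} (ha : 0 < a) (hab : a ≤ b) (u : ℝ) :
    ∫ y in a..b, tailKernel (Polynomial.derivative P) (k + 1) y u =
      tailKernel P k b u - tailKernel P k a u := by
  rcases le_or_gt u a with h | h
  · rw [tailKernel, if_neg (h.trans hab).not_gt, tailKernel, if_neg h.not_gt, sub_zero]
    refine intervalIntegral.integral_zero_ae (ae_of_all _ fun y hy => ?_)
    rw [uIoc_of_le hab] at hy
    rw [tailKernel, if_neg (h.trans hy.1.le).not_gt]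
  · have hu0 : 0 < u := ha.trans h
    have hftc : ∀ c, ∫ y in a..c, (Polynomial.derivative P).eval (y / u) / u ^ (k + 1 + 1) =
        P.eval (c / u) / u ^ (k + 1) - P.eval (a / u) / u ^ (k + 1) := by
      intro c
      have hcont : Continuous fun y =>
          (Polynomial.derivative P).eval (y / u) / u ^ (k + 1 + 1) := by fun_prop
      refine intervalIntegral.integral_eq_sub_of_hasDerivAt
        (f := fun y => P.eval (y / u) / u ^ (k + 1)) (fun y _ => ?_)
        (hcont.intervalIntegrable _ _)
      have h1 := ((P.hasDerivAt (y / u)).comp y ((hasDerivAt_id y).div_const u)).div_const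
        (u ^ (k + 1))
      refine h1.congr_deriv ?_
      rw [pow_succ u (k + 1)]
      field_simp
    rcases lt_or_ge b u with hb | hb
    · rw [tailKernel, if_pos hb, tailKernel, if_pos h, ← hftc b]
      refine intervalIntegral.integral_congr fun y hy => ?_
      rw [uIcc_of_le hab] at hy
      simp only [tailKernel, if_pos (hy.2.trans_lt hb)]
    -- For a < u ≤ b the integrand dies beyond u, so the integral stops at u, where the boundary
    -- value is P(1) = 0.
    · have h1 : P.eval (u / u) / u ^ (k + 1) = 0 := by rw [div_self hu0.ne', hP, zero_div]
      rw [tailKernel, if_neg hb.not_gt, tailKernel, if_pos h, ← h1, ← hftc u,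
        intervalIntegral.integral_of_le hab, intervalIntegral.integral_of_le h.le,
        integral_Ioc_eq_integral_Ioo, integral_Ioc_eq_integral_Ioo]
      have h2 : ∀ y ∈ Ioo a b, tailKernel (Polynomial.derivative P) (k + 1) y u =
          (Iio u).indicator
            (fun y => (Polynomial.derivative P).eval (y / u) / u ^ (k + 1 + 1)) y := by
        intro y _
        simp [tailKernel, indicator]
      rw [setIntegral_congr_fun measurableSet_Ioo h2, setIntegral_indicator measurableSet_Iio,
        Ioo_inter_Iio, min_eq_right hb]

/-- Fubini applied to the kernel identity. The integrated form tolerates atoms of ν and therefore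
gives absolute continuity even where the next transform jumps. -/
theorem tailTransform_sub_eq_integral (ν : Measure ℝ) [IsFiniteMeasure ν] {P : Polynomial ℝ}
    (hP : P.eval 1 = 0) (k : ℕ) {a b : ℝ} (ha : 0 < a) (hab : a ≤ b) :
    tailTransform ν P k b - tailTransform ν P k a =
      ∫ y in a..b, tailTransform ν (Polynomial.derivative P) (k + 1) y := by
  obtain ⟨C, hC, hPC⟩ := (Polynomial.derivative P).exists_abs_eval_le_Icc
  rw [tailTransform, tailTransform, ← integral_sub
    (integrable_tailKernel ν P k (ha.trans_le hab)) (integrable_tailKernel ν P k ha)]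
  simp_rw [← intervalIntegral_tailKernel_derivative hP k ha hab, tailTransform,
    intervalIntegral.integral_of_le hab]
  refine (integral_integral_swap ?_).symm
  refine Integrable.of_bound (measurable_uncurry_tailKernel _ _).aestronglyMeasurable
    (C / a ^ (k + 1 + 1)) ?_
  have h1 : ∀ᵐ z ∂((volume.restrict (Ioc a b)).prod ν), z.1 ∈ Ioc a b :=
    Measure.quasiMeasurePreserving_fst.ae (ae_restrict_mem measurableSet_Ioc)
  exact h1.mono fun z hz => norm_tailKernel_le_of_pos hC hPC (k + 1) ha hz.1.le z.2

theorem AbsolutelyContinuousOnInterval.congr {f g : ℝ → ℝ} {a b : ℝ}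
    (hf : AbsolutelyContinuousOnInterval f a b) (h : EqOn f g (uIcc a b)) :
    AbsolutelyContinuousOnInterval g a b := by
  rw [absolutelyContinuousOnInterval_iff] at hf ⊢
  intro ε hε
  obtain ⟨δ, hδ, H⟩ := hf ε hε
  refine ⟨δ, hδ, fun E hE hlt => ?_⟩
  refine lt_of_eq_of_lt (Finset.sum_congr rfl fun i hi => ?_) (H E hE hlt)
  have := hE.1 i hi
  rw [h this.1, h this.2]

theorem absolutelyContinuousOnInterval_const_add_integral {g : ℝ → ℝ} {a b : ℝ} (c : ℝ)
    (hg : IntervalIntegrable g volume a b) :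
    AbsolutelyContinuousOnInterval (fun x => c + ∫ y in a..x, g y) a b := by
  have hc : AbsolutelyContinuousOnInterval (fun _ : ℝ => c) a b :=
    (LipschitzWith.const c).lipschitzOnWith.absolutelyContinuousOnInterval
  exact hc.add (hg.absolutelyContinuousOnInterval_intervalIntegral left_mem_uIcc)

theorem absolutelyContinuousOnInterval_tailTransform (ν : Measure ℝ) [IsFiniteMeasure ν]
    {P : Polynomial ℝ} (hP : P.eval 1 = 0) (k : ℕ) {a b : ℝ} (ha : 0 < a) (hab : a ≤ b) :
    AbsolutelyContinuousOnInterval (tailTransform ν P k) a b := by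
  refine (absolutelyContinuousOnInterval_const_add_integral (tailTransform ν P k a)
    (intervalIntegrable_tailTransform ν (Polynomial.derivative P) (k + 1) ha hab)).congr
    fun x hx => ?_
  rw [uIcc_of_le hab] at hx
  simp only
  rw [← tailTransform_sub_eq_integral ν hP k ha hx.1]
  ring

theorem continuousAt_tailTransform_of_eval_one (ν : Measure ℝ) [IsFiniteMeasure ν]
    {P : Polynomial ℝ} (hP : P.eval 1 = 0) (k : ℕ) {x : ℝ} (hx : 0 < x) :
    ContinuousAt (tailTransform ν P k) x := by
  have h := (absolutelyContinuousOnInterval_tailTransform ν hP k (half_pos hx)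
    (by linarith : x / 2 ≤ 2 * x)).continuousOn
  rw [uIcc_of_le (by linarith)] at h
  exact h.continuousAt (Icc_mem_nhds (by linarith) (by linarith))

theorem hasDerivAt_tailTransform (ν : Measure ℝ) [IsFiniteMeasure ν]
    {P : Polynomial ℝ} (hP : P.eval 1 = 0) (k : ℕ) {x : ℝ} (hx : 0 < x)
    (hc : ContinuousAt (tailTransform ν (Polynomial.derivative P) (k + 1)) x) :
    HasDerivAt (tailTransform ν P k)
      (tailTransform ν (Polynomial.derivative P) (k + 1) x) x := by
  have h := (intervalIntegral.integral_hasDerivAt_right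
    (intervalIntegrable_tailTransform ν (Polynomial.derivative P) (k + 1) (half_pos hx)
      (by linarith : x / 2 ≤ x))
    (stronglyMeasurable_tailTransform ν _ _).stronglyMeasurableAtFilter hc).const_add
      (tailTransform ν P k (x / 2))
  refine h.congr_of_eventuallyEq ?_
  filter_upwards [lt_mem_nhds (half_lt_self hx)] with y hy
  rw [← tailTransform_sub_eq_integral ν hP k (half_pos hx) hy.le]
  ring

/-! ### Iterated derivatives from a chain of derivatives -/

theorem iteratedDeriv_eqOn_of_hasDerivAt {s : Set ℝ} (hs : IsOpen s) {N : ℕ} {g : ℕ → ℝ → ℝ}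
    (hg : ∀ k < N, ∀ x ∈ s, HasDerivAt (g k) (g (k + 1) x) x) {F : ℝ → ℝ} (hF : EqOn F (g 0) s)
    {k : ℕ} (hk : k ≤ N) : EqOn (iteratedDeriv k F) (g k) s := by
  induction k with
  | zero => simpa using hF
  | succ k ih =>
    intro x hx
    rw [iteratedDeriv_succ]
    have h1 : iteratedDeriv k F =ᶠ[𝓝 x] g k := (ih (by omega)).eventuallyEq_of_mem (hs.mem_nhds hx)
    rw [h1.deriv_eq]
    exact (hg k (by omega) x hx).deriv

theorem contDiffOn_of_hasDerivAt_chain {s : Set ℝ} (hs : IsOpen s) {N : ℕ} {g : ℕ → ℝ → ℝ}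
    (hg : ∀ k < N, ∀ x ∈ s, HasDerivAt (g k) (g (k + 1) x) x) (hc : ContinuousOn (g N) s)
    {F : ℝ → ℝ} (hF : EqOn F (g 0) s) : ContDiffOn ℝ (N : ℕ∞) F s := by
  refine ContDiffOn.congr ?_ hF
  induction N generalizing g F with
  | zero => simpa [contDiffOn_zero] using hc
  | succ N ih =>
    have h := ih (g := fun k => g (k + 1)) (fun k hk x hx => hg (k + 1) (by omega) x hx) hc
      (F := g 1) (fun x _ => rfl)
    have h0 : ∀ x ∈ s, HasDerivAt (g 0) (g 1 x) x := fun x hx => hg 0 (by omega) x hx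
    rw [show (((N + 1 : ℕ) : ℕ∞) : WithTop ℕ∞) = ((N : ℕ∞) : WithTop ℕ∞) + 1 by push_cast; rfl,
      contDiffOn_succ_iff_deriv_of_isOpen hs]
    refine ⟨fun x hx => (h0 x hx).differentiableAt.differentiableWithinAt, by simp, ?_⟩
    exact h.congr fun x hx => (h0 x hx).deriv

/-! ### Hardy's inequality for the dual averaging operator -/

theorem lintegral_rpow_le_mul_measure_univ {α : Type*} [MeasurableSpace α] {μ : Measure α}
    {h : α → ENNReal} (hh : AEMeasurable h μ) {r : ℝ} (hr : 1 ≤ r) :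
    (∫⁻ u, h u ∂μ) ^ r ≤ (∫⁻ u, h u ^ r ∂μ) * μ univ ^ (r - 1) := by
  have hr0 : 0 < r := by linarith
  have h1 := eLpNorm'_le_eLpNorm'_mul_rpow_measure_univ one_pos hr hh.aestronglyMeasurable
  simp only [eLpNorm', enorm_eq_self, ENNReal.rpow_one, div_one] at h1
  have h2 := ENNReal.rpow_le_rpow h1 hr0.le
  rwa [ENNReal.mul_rpow_of_nonneg _ _ hr0.le, ← ENNReal.rpow_mul, ← ENNReal.rpow_mul,
    one_div_mul_cancel hr0.ne', ENNReal.rpow_one, sub_mul, one_div_mul_cancel hr0.ne',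
    one_mul] at h2

theorem lintegral_Ioi_ofReal_rpow {b x : ℝ} (hb : 0 < b) (hx : 0 < x) :
    ∫⁻ u in Ioi x, ENNReal.ofReal (u ^ (-1 - b)) = ENNReal.ofReal (x ^ (-b) / b) := by
  rw [← ofReal_integral_eq_lintegral_ofReal (integrableOn_Ioi_rpow_of_lt (by linarith) hx),
    integral_Ioi_rpow_of_lt (by linarith) hx, show -1 - b + 1 = -b by ring, neg_div_neg_eq]
  exact (ae_restrict_mem measurableSet_Ioi).mono fun u hu =>
    Real.rpow_nonneg (hx.le.trans (le_of_lt hu)) _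

theorem lintegral_Ioo_ofReal_rpow {b u : ℝ} (hb : 0 < b) (hu : 0 < u) :
    ∫⁻ x in Ioo 0 u, ENNReal.ofReal (x ^ (b - 1)) = ENNReal.ofReal (u ^ b / b) := by
  have hint : IntegrableOn (fun x : ℝ => x ^ (b - 1)) (Ioo 0 u) := by
    have := intervalIntegral.intervalIntegrable_rpow' (a := 0) (b := u)
      (by linarith : -1 < b - 1)
    rw [intervalIntegrable_iff_integrableOn_Ioo_of_le hu.le] at this
    exact this
  rw [← ofReal_integral_eq_lintegral_ofReal hint, ← integral_Ioc_eq_integral_Ioo,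
    ← intervalIntegral.integral_of_le hu.le, integral_rpow (Or.inl (by linarith)),
    show b - 1 + 1 = b by ring, Real.zero_rpow hb.ne', sub_zero]
  exact (ae_restrict_mem measurableSet_Ioo).mono fun x hx => Real.rpow_nonneg hx.1.le _

/-- The pointwise weighted Hölder estimate behind Hardy's inequality. -/
theorem rpow_lintegral_Ioi_inv_mul_le {Q : ℝ → ENNReal} (hQ : Measurable Q) {r : ℝ} (hr : 1 ≤ r)
    {x : ℝ} (hx : 0 < x) :
    (∫⁻ u in Ioi x, ENNReal.ofReal (1 / u) * Q u) ^ r ≤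
      ENNReal.ofReal (r ^ (r - 1)) * (ENNReal.ofReal (x ^ (1 / r - 1)) *
        ∫⁻ u in Ioi x, ENNReal.ofReal (u ^ (-(1 / r))) * Q u ^ r) := by
  have hr0 : 0 < r := by linarith
  have hb : 0 < 1 / r := by positivity
  have hwm : Measurable fun u : ℝ => ENNReal.ofReal (u ^ (-1 - 1 / r)) := by fun_prop
  have hhm : Measurable fun u : ℝ => ENNReal.ofReal (u ^ (1 / r)) * Q u := by fun_prop
  have hhrm : Measurable fun u : ℝ => (ENNReal.ofReal (u ^ (1 / r)) * Q u) ^ r := by fun_prop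
  -- Q(u)/u is split as u^(-1-1/r) · u^(1/r) Q(u). The first factor, taken as measure, has mass r
  -- x^(-1/r) on (x,∞).
  have key := lintegral_rpow_le_mul_measure_univ
    (μ := (volume.restrict (Ioi x)).withDensity fun u => ENNReal.ofReal (u ^ (-1 - 1 / r)))
    (h := fun u => ENNReal.ofReal (u ^ (1 / r)) * Q u) hhm.aemeasurable hr
  rw [lintegral_withDensity_eq_lintegral_mul _ hwm hhm,
    lintegral_withDensity_eq_lintegral_mul _ hwm hhrm, withDensity_apply _ MeasurableSet.univ,
    Measure.restrict_univ, lintegral_Ioi_ofReal_rpow hb hx] at key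
  have e1 : ∫⁻ u in Ioi x, ((fun u => ENNReal.ofReal (u ^ (-1 - 1 / r))) *
      fun u => ENNReal.ofReal (u ^ (1 / r)) * Q u) u =
      ∫⁻ u in Ioi x, ENNReal.ofReal (1 / u) * Q u := by
    refine setLIntegral_congr_fun measurableSet_Ioi fun u hu => ?_
    have hu : 0 < u := hx.trans hu
    simp only [Pi.mul_apply]
    rw [← mul_assoc, ← ENNReal.ofReal_mul (by positivity), ← Real.rpow_add hu,
      show -1 - 1 / r + 1 / r = -1 by ring, Real.rpow_neg_one, one_div]
  have e2 : ∫⁻ u in Ioi x, ((fun u => ENNReal.ofReal (u ^ (-1 - 1 / r))) *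
      fun u => (ENNReal.ofReal (u ^ (1 / r)) * Q u) ^ r) u =
      ∫⁻ u in Ioi x, ENNReal.ofReal (u ^ (-(1 / r))) * Q u ^ r := by
    refine setLIntegral_congr_fun measurableSet_Ioi fun u hu => ?_
    have hu : 0 < u := hx.trans hu
    simp only [Pi.mul_apply]
    rw [ENNReal.mul_rpow_of_nonneg _ _ hr0.le, ENNReal.ofReal_rpow_of_pos (by positivity),
      ← Real.rpow_mul hu.le, one_div_mul_cancel hr0.ne', ← mul_assoc,
      ← ENNReal.ofReal_mul (by positivity), ← Real.rpow_add hu,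
      show -1 - 1 / r + 1 = -(1 / r) by ring]
  have e3 : ENNReal.ofReal (x ^ (-(1 / r)) / (1 / r)) ^ (r - 1) =
      ENNReal.ofReal (r ^ (r - 1)) * ENNReal.ofReal (x ^ (1 / r - 1)) := by
    rw [ENNReal.ofReal_rpow_of_pos (by positivity), ← ENNReal.ofReal_mul (by positivity),
      div_div_eq_mul_div, div_one, Real.mul_rpow (by positivity) hr0.le, ← Real.rpow_mul hx.le,
      show -(1 / r) * (r - 1) = 1 / r - 1 by field_simp; ring, mul_comm]
  rw [e1, e2, e3, mul_comm, mul_assoc] at key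
  exact key

/-- Integrate the pointwise estimate and use Tonelli: ∫_0^u x^(1/r-1) dx = r u^(1/r) cancels the
weight, and the constant is r^(r-1) · r. -/
theorem lintegral_rpow_lintegral_Ioi_inv_mul_le {Q : ℝ → ENNReal} (hQ : Measurable Q) {r : ℝ}
    (hr : 1 ≤ r) :
    ∫⁻ x in Ioi 0, (∫⁻ u in Ioi x, ENNReal.ofReal (1 / u) * Q u) ^ r ≤
      ENNReal.ofReal (r ^ r) * ∫⁻ u in Ioi 0, Q u ^ r := by
  have hr0 : 0 < r := by linarith
  have hb : 0 < 1 / r := by positivity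
  set G : ℝ → ENNReal := fun u => ENNReal.ofReal (u ^ (-(1 / r))) * Q u ^ r with hG
  have hGm : Measurable G := by fun_prop
  have hwm : Measurable fun x : ℝ => ENNReal.ofReal (x ^ (1 / r - 1)) := by fun_prop
  have hsw : ∫⁻ x in Ioi 0, ENNReal.ofReal (x ^ (1 / r - 1)) * ∫⁻ u in Ioi x, G u =
      ∫⁻ u in Ioi 0, ENNReal.ofReal r * Q u ^ r := by
    calc _ = ∫⁻ x in Ioi 0, ∫⁻ u in Ioi 0,
          (Iio u).indicator (fun x => ENNReal.ofReal (x ^ (1 / r - 1))) x * G u := by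
          refine setLIntegral_congr_fun measurableSet_Ioi fun x hx => ?_
          have hx : 0 < x := hx
          have hs : Ioi x = Ioi x ∩ Ioi 0 := by
            rw [Ioi_inter_Ioi, max_eq_left hx.le]
          conv_lhs => rw [hs]
          rw [← Measure.restrict_restrict measurableSet_Ioi,
            ← lintegral_indicator measurableSet_Ioi,
            ← lintegral_const_mul _ (hGm.indicator measurableSet_Ioi)]
          refine lintegral_congr fun u => ?_
          by_cases h : x < u <;> simp [h]
      _ = ∫⁻ u in Ioi 0, ∫⁻ x in Ioi 0,
          (Iio u).indicator (fun x => ENNReal.ofReal (x ^ (1 / r - 1))) x * G u := by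
          refine lintegral_lintegral_swap (Measurable.aemeasurable ?_)
          refine Measurable.mul ?_ (hGm.comp measurable_snd)
          have : MeasurableSet {z : ℝ × ℝ | z.1 < z.2} :=
            measurableSet_lt measurable_fst measurable_snd
          exact (hwm.comp measurable_fst).indicator this
      _ = _ := by
          refine setLIntegral_congr_fun measurableSet_Ioi fun u hu => ?_
          have hu : 0 < u := hu
          rw [lintegral_mul_const _ (hwm.indicator measurableSet_Iio),
            lintegral_indicator measurableSet_Iio, Measure.restrict_restrict measurableSet_Iio,
            Iio_inter_Ioi, lintegral_Ioo_ofReal_rpow hb hu, hG]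
          simp only
          rw [← mul_assoc, ← ENNReal.ofReal_mul (by positivity), Real.rpow_neg hu.le]
          congr 2
          field_simp
  calc _ ≤ ∫⁻ x in Ioi 0, ENNReal.ofReal (r ^ (r - 1)) *
        (ENNReal.ofReal (x ^ (1 / r - 1)) * ∫⁻ u in Ioi x, G u) :=
        setLIntegral_mono' measurableSet_Ioi fun x hx => rpow_lintegral_Ioi_inv_mul_le hQ hr hx
    _ = ENNReal.ofReal (r ^ (r - 1)) * (ENNReal.ofReal r * ∫⁻ u in Ioi 0, Q u ^ r) := by
        rw [lintegral_const_mul' _ _ ENNReal.ofReal_ne_top, hsw,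
          lintegral_const_mul' _ _ ENNReal.ofReal_ne_top]
    _ = _ := by
        rw [← mul_assoc, ← ENNReal.ofReal_mul (by positivity), ← Real.rpow_add_one hr0.ne']
        ring_nf

/-! ### Regularity of the transition density -/

/-- The polynomial `t^{m-1} (1 - t²)^{j-1}`, the shape of the transition density. -/
noncomputable def transitionPoly (m j : ℕ) : Polynomial ℝ :=
  Polynomial.X ^ (m - 1) * (1 - Polynomial.X ^ 2) ^ (j - 1)

/-- (t - 1)^(j-1) divides the polynomial, and each derivative costs at most one factor. -/
theorem eval_one_iterate_derivative_transitionPoly {m j k : ℕ} (hk : k + 1 < j) :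
    (Polynomial.derivative^[k] (transitionPoly m j)).eval 1 = 0 := by
  have h1 : (Polynomial.X - Polynomial.C (1 : ℝ)) ^ (j - 1) ∣ transitionPoly m j := by
    refine Dvd.dvd.mul_left (pow_dvd_pow_of_dvd ⟨-(Polynomial.X + 1), ?_⟩ _) _
    rw [Polynomial.C_1]
    ring
  have h2 := Polynomial.pow_sub_dvd_iterate_derivative_of_pow_dvd k h1
  have h3 : (Polynomial.X - Polynomial.C (1 : ℝ)) ∣
      Polynomial.derivative^[k] (transitionPoly m j) :=
    (dvd_pow_self _ (by omega)).trans h2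
  exact Polynomial.dvd_iff_isRoot.1 h3

/-- The formal `k`-th derivative of the transition density under the integral sign. -/
noncomputable def transitionDeriv (m j : ℕ) (ν : Measure ℝ) (k : ℕ) (x : ℝ) : ℝ :=
  2 / ProbabilityTheory.beta (m / 2) j *
    tailTransform ν (Polynomial.derivative^[k] (transitionPoly m j)) k x

theorem transitionDensity_eq_transitionDeriv {m : ℕ} (hm : 1 ≤ m) (j : ℕ) (ν : Measure ℝ) (x : ℝ) :
    transitionDensity m j ν x = transitionDeriv m j ν 0 x := by
  rw [transitionDensity, transitionDeriv, tailTransform, mul_div_right_comm, mul_assoc,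
    ← integral_const_mul, ← integral_indicator measurableSet_Ioi]
  congr 2
  funext u
  rw [tailKernel, indicator]
  refine if_congr Iff.rfl ?_ rfl
  obtain ⟨l, rfl⟩ : ∃ l, m = l + 1 := ⟨m - 1, by omega⟩
  simp [transitionPoly, div_pow, pow_succ]
  ring

theorem stronglyMeasurable_transitionDeriv (m j : ℕ) (ν : Measure ℝ) [SFinite ν] (k : ℕ) :
    StronglyMeasurable (transitionDeriv m j ν k) :=
  (stronglyMeasurable_tailTransform ν _ k).const_mul _

section Chain

variable {m j : ℕ} {ν : Measure ℝ} [IsFiniteMeasure ν] {k : ℕ} {x : ℝ}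

theorem continuousAt_transitionDeriv (hx : 0 < x) (h : k + 1 < j ∨ ν {x} = 0) :
    ContinuousAt (transitionDeriv m j ν k) x := by
  refine ContinuousAt.mul continuousAt_const ?_
  rcases h with h | h
  · exact continuousAt_tailTransform_of_eval_one ν
      (eval_one_iterate_derivative_transitionPoly h) k hx
  · exact continuousAt_tailTransform ν _ k hx h

theorem hasDerivAt_transitionDeriv (hk : k + 1 < j) (hx : 0 < x)
    (h : k + 1 + 1 < j ∨ ν {x} = 0) :
    HasDerivAt (transitionDeriv m j ν k) (transitionDeriv m j ν (k + 1) x) x := by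
  have he := eval_one_iterate_derivative_transitionPoly (m := m) hk
  have hc : ContinuousAt (tailTransform ν
      (Polynomial.derivative (Polynomial.derivative^[k] (transitionPoly m j))) (k + 1)) x := by
    rw [← Function.iterate_succ_apply' Polynomial.derivative]
    rcases h with h | h
    · exact continuousAt_tailTransform_of_eval_one ν
        (eval_one_iterate_derivative_transitionPoly h) _ hx
    · exact continuousAt_tailTransform ν _ _ hx h
  have := (hasDerivAt_tailTransform ν he k hx hc).const_mul
    (2 / ProbabilityTheory.beta (m / 2) j)
  rw [← Function.iterate_succ_apply' Polynomial.derivative] at this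
  exact this

theorem isACLoc_transitionDeriv (hk : k + 1 < j) : IsACLoc (transitionDeriv m j ν k) :=
  fun _ _ ha hab => (absolutelyContinuousOnInterval_tailTransform ν
    (eval_one_iterate_derivative_transitionPoly hk) k ha hab).const_mul _

theorem iteratedDeriv_transitionDensity_of_lt (hm : 1 ≤ m) (hk : k + 1 < j) :
    EqOn (iteratedDeriv k (transitionDensity m j ν)) (transitionDeriv m j ν k) (Ioi 0) :=
  iteratedDeriv_eqOn_of_hasDerivAt isOpen_Ioi (N := k)
    (g := transitionDeriv m j ν)
    (fun _ hi _ hx => hasDerivAt_transitionDeriv (by omega) hx (Or.inl (by omega)))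
    (fun x _ => transitionDensity_eq_transitionDeriv hm j ν x) le_rfl

/-- This includes the top order k = j - 1, where the kernel may jump; hence the condition on the
atom at x. -/
theorem iteratedDeriv_transitionDensity (hm : 1 ≤ m) (hk : k < j) (hx : 0 < x) (hν : ν {x} = 0) :
    iteratedDeriv k (transitionDensity m j ν) x = transitionDeriv m j ν k x := by
  rcases k with _ | k
  · simpa using transitionDensity_eq_transitionDeriv hm j ν _
  · have h1 : iteratedDeriv k (transitionDensity m j ν) =ᶠ[𝓝 x] transitionDeriv m j ν k :=
      (iteratedDeriv_transitionDensity_of_lt hm hk).eventuallyEq_of_mem (Ioi_mem_nhds hx)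
    rw [iteratedDeriv_succ, h1.deriv_eq]
    exact (hasDerivAt_transitionDeriv hk hx (Or.inr hν)).deriv

theorem ae_measure_singleton_eq_zero (ν : Measure ℝ) [IsFiniteMeasure ν] :
    ∀ᵐ x : ℝ, ν {x} = 0 := by
  have h := Measure.countable_meas_level_set_pos (μ := ν) (g := id) measurable_id
  have h2 := h.ae_notMem volume
  filter_upwards [h2] with x hx
  simpa using hx

theorem ae_iteratedDeriv_transitionDensity (ν : Measure ℝ) [IsFiniteMeasure ν] (hm : 1 ≤ m)
    (hk : k < j) :
    (fun x => x ^ k * iteratedDeriv k (transitionDensity m j ν) x) =ᵐ[volume.restrict (Ioi 0)]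
      fun x => x ^ k * transitionDeriv m j ν k x := by
  filter_upwards [ae_restrict_mem measurableSet_Ioi,
    ae_restrict_of_ae (ae_measure_singleton_eq_zero ν)] with x hx hνx
  rw [iteratedDeriv_transitionDensity hm hk hx hνx]

end Chain

/-- On x < u one has x^k ≤ u^k, which absorbs all but one power of 1/u. Both the L^p and the L^∞
bounds rest on this. -/
theorem exists_enorm_pow_mul_transitionDeriv_le (m j : ℕ) (ν : Measure ℝ) (k : ℕ) :
    ∃ C : ℝ, ∀ x, 0 < x → ‖x ^ k * transitionDeriv m j ν k x‖ₑ ≤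
      ENNReal.ofReal C * ∫⁻ u in Ioi x, ENNReal.ofReal (1 / u) ∂ν := by
  obtain ⟨C, hC, hP⟩ :=
    (Polynomial.derivative^[k] (transitionPoly m j)).exists_abs_eval_le_Icc
  set c := 2 / ProbabilityTheory.beta (m / 2 : ℝ) j with hc
  refine ⟨|c| * C, fun x hx => ?_⟩
  rw [transitionDeriv, tailTransform, ← hc, ← mul_assoc, ← integral_const_mul,
    ← lintegral_const_mul' _ _ ENNReal.ofReal_ne_top, ← lintegral_indicator measurableSet_Ioi]
  refine (enorm_integral_le_lintegral_enorm _).trans (lintegral_mono fun u => ?_)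
  by_cases hu : x < u
  · have hu0 : 0 < u := hx.trans hu
    rw [indicator_of_mem (show u ∈ Ioi x from hu), ← ofReal_norm,
      ← ENNReal.ofReal_mul (by positivity)]
    refine ENNReal.ofReal_le_ofReal ?_
    rw [norm_mul, norm_mul, norm_pow, Real.norm_of_nonneg hx.le, Real.norm_eq_abs c]
    calc x ^ k * |c| * ‖tailKernel (Polynomial.derivative^[k] (transitionPoly m j)) k x u‖
        ≤ u ^ k * |c| * (C / u ^ (k + 1)) := by
          gcongr
          exact norm_tailKernel_le hP k hx.le hu
      _ = |c| * C * (1 / u) := by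
          rw [pow_succ]
          field_simp
  · simp [tailKernel, hu]

/-- The transform is at most C x^(-k-1) ν((x,∞)), and the tail mass of a finite measure tends to 0.
-/
theorem isLittleO_transitionDeriv (m j : ℕ) (ν : Measure ℝ) [IsFiniteMeasure ν] (k : ℕ) :
    transitionDeriv m j ν k =o[atTop] fun x : ℝ => 1 / x ^ (k + 1) := by
  obtain ⟨C, hC, hP⟩ :=
    (Polynomial.derivative^[k] (transitionPoly m j)).exists_abs_eval_le_Icc
  refine Asymptotics.IsLittleO.const_mul_left ?_ _
  have hν : Tendsto (fun x : ℝ => ν.real (Ioi x)) atTop (𝓝 0) := by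
    have h := tendsto_measure_iInter_atTop (μ := ν) (s := fun x : ℝ => Ioi x)
      (fun x => measurableSet_Ioi.nullMeasurableSet) (fun x y hxy => Ioi_subset_Ioi hxy)
      ⟨0, measure_ne_top _ _⟩
    have he : ⋂ x : ℝ, Ioi x = ∅ := by
      ext y
      simp only [mem_iInter, mem_Ioi, mem_empty_iff_false, iff_false, not_forall, not_lt]
      exact ⟨y, le_rfl⟩
    rw [he, measure_empty] at h
    exact (ENNReal.tendsto_toReal ENNReal.zero_ne_top).comp h
  have h1 : (fun x : ℝ => C * ν.real (Ioi x)) =o[atTop] fun _ => (1 : ℝ) := by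
    rw [Asymptotics.isLittleO_one_iff]
    simpa using hν.const_mul C
  have h2 := (Asymptotics.isBigO_refl (fun x : ℝ => 1 / x ^ (k + 1)) atTop).mul_isLittleO h1
  simp only [mul_one] at h2
  refine Asymptotics.IsBigO.trans_isLittleO ?_ h2
  refine Asymptotics.IsBigO.of_bound 1 ?_
  filter_upwards [eventually_gt_atTop 0] with x hx
  refine (norm_tailTransform_le_of_pos ν hP k hx).trans (le_of_eq ?_)
  rw [Real.norm_of_nonneg (by positivity)]
  ring

/-! ### Behaviour at the origin -/

/-- Dominated convergence with majorant C/u: for fixed u > 0 the kernel tends to P(0)/u. -/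
theorem tendsto_tailTransform_zero {ν : Measure ℝ} (P : Polynomial ℝ)
    (hI : IntegrableOn (fun u : ℝ => 1 / u) (Ioi 0) ν) :
    Tendsto (tailTransform ν P 0) (𝓝[>] 0) (𝓝 (P.eval 0 * ∫ u in Ioi (0 : ℝ), 1 / u ∂ν)) := by
  obtain ⟨C, hC, hP⟩ := P.exists_abs_eval_le_Icc
  rw [← integral_const_mul, ← integral_indicator measurableSet_Ioi]
  have hb : Integrable ((Ioi (0 : ℝ)).indicator fun u => C * (1 / u)) ν :=
    IntegrableOn.integrable_indicator (hI.const_mul C) measurableSet_Ioi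
  refine tendsto_integral_filter_of_dominated_convergence _
    (Eventually.of_forall fun x => (measurable_tailKernel P 0 x).aestronglyMeasurable) ?_ hb ?_
  · filter_upwards [self_mem_nhdsWithin] with x hx
    have hx : 0 < x := hx
    refine ae_of_all _ fun u => ?_
    by_cases hu : x < u
    · rw [indicator_of_mem (show u ∈ Ioi 0 from hx.trans hu)]
      exact (norm_tailKernel_le hP 0 hx.le hu).trans (le_of_eq (by ring))
    · rw [tailKernel, if_neg hu, norm_zero]
      exact indicator_nonneg (fun u hu => mul_nonneg hC (one_div_nonneg.2 (le_of_lt hu))) u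
  · refine ae_of_all _ fun u => ?_
    by_cases hu : 0 < u
    · rw [indicator_of_mem (show u ∈ Ioi 0 from hu)]
      have hc : Continuous fun x => P.eval (x / u) * (1 / u) := by fun_prop
      have ht : Tendsto (fun x => P.eval (x / u) * (1 / u)) (𝓝[>] 0)
          (𝓝 (P.eval 0 * (1 / u))) := by
        simpa using (hc.tendsto 0).mono_left nhdsWithin_le_nhds
      refine ht.congr' ?_
      filter_upwards [Ioo_mem_nhdsGT hu] with x hx
      rw [tailKernel, if_pos hx.2]
      ring
    · rw [indicator_of_notMem (show u ∉ Ioi 0 from hu)]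
      refine tendsto_const_nhds.congr' ?_
      filter_upwards [self_mem_nhdsWithin] with x hx
      have hx : 0 < x := hx
      rw [tailKernel, if_neg (by linarith)]

theorem tendsto_transitionDensity_zero {m : ℕ} (hm : 1 ≤ m) (j : ℕ) {ν : Measure ℝ}
    (hI : IntegrableOn (fun u : ℝ => 1 / u) (Ioi 0) ν) :
    Tendsto (transitionDensity m j ν) (𝓝[>] 0)
      (𝓝 (2 / ProbabilityTheory.beta (m / 2) j *
        (0 ^ (m - 1) * ∫ u in Ioi (0 : ℝ), 1 / u ∂ν))) := by
  have h := (tendsto_tailTransform_zero (transitionPoly m j) hI).const_mul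
    (2 / ProbabilityTheory.beta (m / 2 : ℝ) j)
  have he : (transitionPoly m j).eval 0 = 0 ^ (m - 1) := by simp [transitionPoly]
  rw [he] at h
  exact h.congr fun x => (transitionDensity_eq_transitionDeriv hm j ν x).symm

/-! ### Integrability -/

theorem memLp_top_transitionDeriv (m j : ℕ) {ν : Measure ℝ} [IsFiniteMeasure ν] (k : ℕ)
    (hI : IntegrableOn (fun u : ℝ => 1 / u) (Ioi 0) ν) :
    MemLp (fun x => x ^ k * transitionDeriv m j ν k x) ⊤ (volume.restrict (Ioi 0)) := by
  obtain ⟨C, hC⟩ := exists_enorm_pow_mul_transitionDeriv_le m j ν k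
  have hfin : ∫⁻ u in Ioi 0, ENNReal.ofReal (1 / u) ∂ν < ⊤ := by
    refine lt_of_le_of_lt (lintegral_mono fun u => ?_) hI.2
    exact Real.ofReal_le_enorm _
  refine ⟨((continuous_pow k).stronglyMeasurable.mul
    (stronglyMeasurable_transitionDeriv m j ν k)).aestronglyMeasurable, ?_⟩
  rw [eLpNorm_exponent_top]
  refine lt_of_le_of_lt (eLpNormEssSup_le_of_ae_enorm_bound
    (C := ENNReal.ofReal C * ∫⁻ u in Ioi 0, ENNReal.ofReal (1 / u) ∂ν) ?_)
    (ENNReal.mul_lt_top ENNReal.ofReal_lt_top hfin)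
  refine (ae_restrict_mem measurableSet_Ioi).mono fun x hx => (hC x hx).trans ?_
  gcongr
  exact le_of_lt hx

theorem memLp_transitionDeriv (m j : ℕ) {ν : Measure ℝ} [IsFiniteMeasure ν] (k : ℕ)
    {p : ENNReal} {q : ℝ → ℝ} (hp : 1 ≤ p) (hp' : p ≠ ⊤)
    (hν : ν = (volume.restrict (Ioi 0)).withDensity fun x => ENNReal.ofReal (q x))
    (hq : MemLp q p (volume.restrict (Ioi 0))) :
    MemLp (fun x => x ^ k * transitionDeriv m j ν k x) p (volume.restrict (Ioi 0)) := by
  obtain ⟨C, hC⟩ := exists_enorm_pow_mul_transitionDeriv_le m j ν k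
  have hp0 : p ≠ 0 := (one_pos.trans_le hp).ne'
  have hr : 1 ≤ p.toReal := by simpa using ENNReal.toReal_mono hp' hp
  have hr0 : 0 ≤ p.toReal := by linarith
  -- Hardy's inequality needs a measurable density, while q is only a.e. strongly measurable; a
  -- representative leaves ν unchanged.
  set q' := hq.1.mk q with hq'
  have hqq' : q =ᵐ[volume.restrict (Ioi 0)] q' := hq.1.ae_eq_mk
  have hq'm : Measurable q' := hq.1.stronglyMeasurable_mk.measurable
  set Q : ℝ → ENNReal := fun u => ENNReal.ofReal (q' u) with hQ
  have hQm : Measurable Q := hq'm.ennreal_ofReal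
  have hν' : ν = (volume.restrict (Ioi 0)).withDensity Q := by
    rw [hν]
    refine withDensity_congr_ae ?_
    filter_upwards [hqq'] with u hu
    rw [hQ, hu]
  have htail : ∀ x, 0 < x → ∫⁻ u in Ioi x, ENNReal.ofReal (1 / u) ∂ν =
      ∫⁻ u in Ioi x, ENNReal.ofReal (1 / u) * Q u := by
    intro x hx
    rw [hν', restrict_withDensity measurableSet_Ioi,
      Measure.restrict_restrict measurableSet_Ioi, Ioi_inter_Ioi, max_eq_left hx.le,
      lintegral_withDensity_eq_lintegral_mul _ hQm (by fun_prop)]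
    exact lintegral_congr fun u => mul_comm (Q u) _
  have hQfin : ∫⁻ u in Ioi 0, Q u ^ p.toReal < ⊤ := by
    have h1 : MemLp q' p (volume.restrict (Ioi 0)) := (memLp_congr_ae hqq').1 hq
    have h2 := (eLpNorm_lt_top_iff_lintegral_rpow_enorm_lt_top hp0 hp').1 h1.2
    refine lt_of_le_of_lt (lintegral_mono fun u => ?_) h2
    exact ENNReal.rpow_le_rpow (Real.ofReal_le_enorm _) hr0
  refine ⟨((continuous_pow k).stronglyMeasurable.mul
    (stronglyMeasurable_transitionDeriv m j ν k)).aestronglyMeasurable, ?_⟩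
  rw [eLpNorm_lt_top_iff_lintegral_rpow_enorm_lt_top hp0 hp']
  calc ∫⁻ x in Ioi 0, ‖x ^ k * transitionDeriv m j ν k x‖ₑ ^ p.toReal
      ≤ ∫⁻ x in Ioi 0, ENNReal.ofReal C ^ p.toReal *
          (∫⁻ u in Ioi x, ENNReal.ofReal (1 / u) * Q u) ^ p.toReal := by
        refine setLIntegral_mono' measurableSet_Ioi fun x hx => ?_
        rw [← ENNReal.mul_rpow_of_nonneg _ _ hr0, ← htail x hx]
        exact ENNReal.rpow_le_rpow (hC x hx) hr0
    _ ≤ ENNReal.ofReal C ^ p.toReal *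
          (ENNReal.ofReal (p.toReal ^ p.toReal) * ∫⁻ u in Ioi 0, Q u ^ p.toReal) := by
        rw [lintegral_const_mul' _ _ (ENNReal.rpow_ne_top_of_nonneg hr0 ENNReal.ofReal_ne_top)]
        gcongr
        exact lintegral_rpow_lintegral_Ioi_inv_mul_le hQm hr
    _ < ⊤ := ENNReal.mul_lt_top
        (ENNReal.rpow_lt_top_of_nonneg hr0 ENNReal.ofReal_ne_top)
        (ENNReal.mul_lt_top ENNReal.ofReal_lt_top hQfin)

/-! ### The distribution function -/

theorem transitionDensity_nonneg {m j : ℕ} (hm : 1 ≤ m) (hj : 1 ≤ j) (ν : Measure ℝ) {x : ℝ}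
    (hx : 0 < x) : 0 ≤ transitionDensity m j ν x := by
  have hB := beta_half_pos hm hj
  refine mul_nonneg (by positivity) (setIntegral_nonneg measurableSet_Ioi fun u hu => ?_)
  have hu : x < u := hu
  have hu0 : 0 < u := hx.trans hu
  have h1 : x ^ 2 / u ^ 2 ≤ 1 := by
    rw [div_le_one (by positivity)]
    exact pow_le_pow_left₀ hx.le hu.le 2
  have : 0 ≤ 1 - x ^ 2 / u ^ 2 := by linarith
  positivity

section Distribution

variable {m j : ℕ} {νm ν : Measure ℝ} [IsFiniteMeasure νm] [IsFiniteMeasure ν]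

theorem integrableOn_transitionDensity (hm : 1 ≤ m) (hj : 1 ≤ j)
    (h : νm.restrict (Ioi 0) = (volume.restrict (Ioi 0)).withDensity
      fun x => ENNReal.ofReal (transitionDensity m j ν x)) :
    IntegrableOn (transitionDensity m j ν) (Ioi 0) := by
  refine ⟨(stronglyMeasurable_transitionDeriv m j ν 0).aestronglyMeasurable.congr ?_, ?_⟩
  · exact ae_of_all _ fun x => (transitionDensity_eq_transitionDeriv hm j ν x).symm
  · rw [hasFiniteIntegral_iff_ofReal]
    · have h1 := congrArg (fun κ : Measure ℝ => κ univ) h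
      simp only [withDensity_apply _ MeasurableSet.univ, Measure.restrict_univ] at h1
      rw [← h1]
      exact measure_lt_top _ _
    · exact (ae_restrict_mem measurableSet_Ioi).mono fun x hx => transitionDensity_nonneg hm hj ν hx

theorem measureReal_Iic_eq_add_integral (hm : 1 ≤ m) (hj : 1 ≤ j)
    (h : νm.restrict (Ioi 0) = (volume.restrict (Ioi 0)).withDensity
      fun x => ENNReal.ofReal (transitionDensity m j ν x)) {x : ℝ} (hx : 0 ≤ x) :
    νm.real (Iic x) = νm.real (Iic 0) + ∫ y in 0..x, transitionDensity m j ν y := by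
  have hint := integrableOn_transitionDensity hm hj h
  rw [← Iic_union_Ioc_eq_Iic hx, measureReal_union (Iic_disjoint_Ioc le_rfl) measurableSet_Ioc,
    intervalIntegral.integral_of_le hx]
  congr 1
  have hsub : Ioc 0 x ⊆ Ioi 0 := fun y hy => hy.1
  have h1 : νm (Ioc 0 x) = ∫⁻ y in Ioc 0 x, ENNReal.ofReal (transitionDensity m j ν y) := by
    rw [← Measure.restrict_eq_self νm hsub, h, withDensity_apply _ measurableSet_Ioc,
      Measure.restrict_restrict measurableSet_Ioc, inter_eq_left.2 hsub]
  rw [measureReal_def, h1, ← ofReal_integral_eq_lintegral_ofReal (hint.mono_set hsub)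
    ((ae_restrict_mem measurableSet_Ioc).mono fun y hy => transitionDensity_nonneg hm hj ν hy.1),
    ENNReal.toReal_ofReal]
  exact setIntegral_nonneg measurableSet_Ioc fun y hy => transitionDensity_nonneg hm hj ν hy.1

theorem absolutelyContinuousOnInterval_measureReal_Iic (hm : 1 ≤ m) (hj : 1 ≤ j)
    (h : νm.restrict (Ioi 0) = (volume.restrict (Ioi 0)).withDensity
      fun x => ENNReal.ofReal (transitionDensity m j ν x)) {a : ℝ} (ha : 0 ≤ a) :
    AbsolutelyContinuousOnInterval (fun x => νm.real (Iic x)) 0 a := by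
  have hint : IntervalIntegrable (transitionDensity m j ν) volume 0 a := by
    rw [intervalIntegrable_iff_integrableOn_Ioc_of_le ha]
    exact (integrableOn_transitionDensity hm hj h).mono_set fun y hy => hy.1
  refine (absolutelyContinuousOnInterval_const_add_integral (νm.real (Iic 0)) hint).congr
    fun x hx => ?_
  rw [uIcc_of_le ha] at hx
  exact (measureReal_Iic_eq_add_integral hm hj h hx.1).symm

theorem hasDerivAt_measureReal_Iic (hm : 1 ≤ m) (hj : 2 ≤ j)
    (h : νm.restrict (Ioi 0) = (volume.restrict (Ioi 0)).withDensity
      fun x => ENNReal.ofReal (transitionDensity m j ν x)) {x : ℝ} (hx : 0 < x) :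
    HasDerivAt (fun x => νm.real (Iic x)) (transitionDeriv m j ν 0 x) x := by
  have hint := integrableOn_transitionDensity hm (by omega) h
  have heq : transitionDensity m j ν = transitionDeriv m j ν 0 :=
    funext (transitionDensity_eq_transitionDeriv hm j ν)
  have hc : ContinuousAt (transitionDensity m j ν) x :=
    heq ▸ continuousAt_transitionDeriv hx (Or.inl (by omega))
  have h1 := (intervalIntegral.integral_hasDerivAt_right (a := 0)
    ((intervalIntegrable_iff_integrableOn_Ioc_of_le hx.le).2
      (hint.mono_set fun y (hy : y ∈ Ioc 0 x) => hy.1))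
    ⟨Ioi 0, Ioi_mem_nhds hx, hint.1⟩ hc).const_add (νm.real (Iic 0))
  rw [transitionDensity_eq_transitionDeriv hm j ν x] at h1
  refine h1.congr_of_eventuallyEq ?_
  filter_upwards [Ioi_mem_nhds hx] with y hy
  exact measureReal_Iic_eq_add_integral hm (by omega) h (le_of_lt hy)

theorem isACLocPow_measureReal_Iic (hm : 1 ≤ m) (hj : 1 ≤ j)
    (h : νm.restrict (Ioi 0) = (volume.restrict (Ioi 0)).withDensity
      fun x => ENNReal.ofReal (transitionDensity m j ν x)) :
    IsACLocPow j (fun x => νm.real (Iic x)) := by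
  have hac : IsACLoc fun x => νm.real (Iic x) := fun a b ha hab =>
    (absolutelyContinuousOnInterval_measureReal_Iic hm hj h (ha.le.trans hab)).mono (by
      rw [uIcc_of_le hab, uIcc_of_le (ha.le.trans hab)]
      exact Icc_subset_Icc_left ha.le)
  -- For j = 1 the density may jump at atoms of ν, so only continuity and absolute continuity of the
  -- distribution function are claimed.
  rcases hj.eq_or_lt with rfl | hj2
  · refine ⟨?_, by simpa using hac⟩
    simp only [Nat.sub_self, Nat.cast_zero]
    refine contDiffOn_zero.2 fun x hx => ?_
    have hx : 0 < x := hx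
    have hcont := (hac (x / 2) (2 * x) (by positivity) (by linarith)).continuousOn
    rw [uIcc_of_le (by linarith)] at hcont
    exact (hcont.continuousAt (Icc_mem_nhds (by linarith) (by linarith))).continuousWithinAt
  · obtain ⟨i, rfl⟩ : ∃ i, j = i + 2 := ⟨j - 2, by omega⟩
    -- The distribution function heads the chain and shifts it by one: its derivative of order j - 1
    -- = i + 1 is `transitionDeriv` of order i, the last absolutely continuous one.
    set g : ℕ → ℝ → ℝ := fun k => Nat.casesOn k (fun x => νm.real (Iic x))
      (fun k => transitionDeriv m (i + 2) ν k) with hg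
    have hchain : ∀ k < i + 1, ∀ x ∈ Ioi (0 : ℝ), HasDerivAt (g k) (g (k + 1) x) x := by
      rintro (_ | k) hk x hx
      · exact hasDerivAt_measureReal_Iic hm hj2 h hx
      · exact hasDerivAt_transitionDeriv (by omega) hx (Or.inl (by omega))
    refine ⟨contDiffOn_of_hasDerivAt_chain isOpen_Ioi hchain (fun x hx => ?_) fun x _ => rfl,
      fun a b ha hab => ?_⟩
    · exact (continuousAt_transitionDeriv hx (Or.inl (by omega))).continuousWithinAt
    · refine (isACLoc_transitionDeriv (by omega : i + 1 < i + 2) a b ha hab :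
        AbsolutelyContinuousOnInterval (transitionDeriv m (i + 2) ν i) a b).congr fun x hx => ?_
      rw [uIcc_of_le hab] at hx
      exact (iteratedDeriv_eqOn_of_hasDerivAt isOpen_Ioi hchain (fun x _ => rfl) le_rfl
        (ha.trans_le hx.1)).symm

end Distribution

theorem isACLocPow_transitionDensity {m j : ℕ} {ν : Measure ℝ} [IsFiniteMeasure ν] (hm : 1 ≤ m)
    (hj : 2 ≤ j) : IsACLocPow (j - 1) (transitionDensity m j ν) := by
  refine ⟨contDiffOn_of_hasDerivAt_chain isOpen_Ioi (g := transitionDeriv m j ν)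
    (fun k hk x hx => hasDerivAt_transitionDeriv (by omega) hx (Or.inl (by omega)))
    (fun x hx => (continuousAt_transitionDeriv hx (Or.inl (by omega))).continuousWithinAt)
    (fun x _ => transitionDensity_eq_transitionDeriv hm j ν x), fun a b ha hab => ?_⟩
  refine (isACLoc_transitionDeriv (by omega : j - 1 - 1 + 1 < j) a b ha hab :
    AbsolutelyContinuousOnInterval (transitionDeriv m j ν (j - 1 - 1)) a b).congr fun x hx => ?_
  rw [uIcc_of_le hab] at hx
  exact (iteratedDeriv_transitionDensity_of_lt hm (by omega) (ha.trans_le hx.1)).symm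

theorem contDiffOn_transitionDensity {m j : ℕ} {ν : Measure ℝ} [IsFiniteMeasure ν] (hm : 1 ≤ m)
    (hj : 1 ≤ j) (hν : ∀ x, ν {x} = 0) :
    ContDiffOn ℝ ((j - 1 : ℕ) : ℕ∞) (transitionDensity m j ν) (Ioi 0) :=
  contDiffOn_of_hasDerivAt_chain isOpen_Ioi (g := transitionDeriv m j ν)
    (fun k hk x hx => hasDerivAt_transitionDeriv (by omega) hx (Or.inr (hν x)))
    (fun x hx => (continuousAt_transitionDeriv hx (Or.inr (hν x))).continuousWithinAt)
    (fun x _ => transitionDensity_eq_transitionDeriv hm j ν x)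

theorem mainTheorem5 (m j : ℕ) (hm : 1 ≤ m) (hj : 1 ≤ j) (f : ℝ → ℝ)
    (hnonconst : ¬ ∃ c : ℝ, ∀ r : ℝ, 0 ≤ r → f r = c)
    (hfm : IsRPD m f) (νm : Measure ℝ) (hνm : IsSchoenbergMeasure m f νm)
    (hf : IsRPD (m + 2 * j) f) (ν : Measure ℝ) (hν : IsSchoenbergMeasure (m + 2 * j) f ν) :
    -- `p_m` is the density of `ν_m` on `(0,∞)`
    νm.restrict (Ioi 0) = (volume.restrict (Ioi 0)).withDensity
        (fun x => ENNReal.ofReal (transitionDensity m j ν x)) ∧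
    -- (i)
    ((∀ a : ℝ, 0 < a → AbsolutelyContinuousOnInterval (fun x => νm.real (Iic x)) 0 a) ∧
      IsACLocPow j (fun x => νm.real (Iic x)) ∧
      (2 ≤ j → IsACLocPow (j - 1) (transitionDensity m j ν))) ∧
    -- (ii)
    (∀ (p : ENNReal) (q : ℝ → ℝ), 1 ≤ p → p ≠ ⊤ → (∀ x, 0 ≤ q x) →
      ν = (volume.restrict (Ioi 0)).withDensity (fun x => ENNReal.ofReal (q x)) →
      MemLp q p (volume.restrict (Ioi 0)) →
        ContDiffOn ℝ ((j - 1 : ℕ) : ℕ∞) (transitionDensity m j ν) (Ioi 0) ∧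
        ∀ k < j,
          MemLp (fun x => x ^ k * iteratedDeriv k (transitionDensity m j ν) x) p
            (volume.restrict (Ioi 0)) ∧
          (fun x => iteratedDeriv k (transitionDensity m j ν) x)
            =o[atTop] (fun x : ℝ => 1 / x ^ (k + 1))) ∧
    -- (iii)
    (IntegrableOn (fun u : ℝ => 1 / u) (Ioi 0) ν →
      (2 ≤ m → transitionDensity m j ν 0 = 0 ∧
        Tendsto (transitionDensity m j ν) (𝓝[>] 0) (𝓝 0)) ∧
      (m = 1 →
        transitionDensity m j ν 0
          = 2 / ProbabilityTheory.beta (1 / 2) j * ∫ u in Ioi (0 : ℝ), 1 / u ∂ν ∧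
        Tendsto (transitionDensity m j ν) (𝓝[>] 0)
          (𝓝 (2 / ProbabilityTheory.beta (1 / 2) j * ∫ u in Ioi (0 : ℝ), 1 / u ∂ν))) ∧
      ∀ k < j,
        MemLp (fun x => x ^ k * iteratedDeriv k (transitionDensity m j ν) x) ⊤
          (volume.restrict (Ioi 0))) := by
  have := hνm.finite
  have := hν.finite
  have hdens := hνm.restrict_Ioi_eq_withDensity hm hj hν
  refine ⟨hdens, ⟨fun a ha => absolutelyContinuousOnInterval_measureReal_Iic hm hj hdens ha.le,
    isACLocPow_measureReal_Iic hm hj hdens, isACLocPow_transitionDensity hm⟩, ?_, ?_⟩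
  · intro p q hp hp' _ hνq hq
    -- A density excludes atoms, so the derivative of order j - 1 exists and is continuous
    -- throughout (0,∞).
    have hν0 : ∀ x, ν {x} = 0 := by
      intro x
      rw [hνq]
      exact withDensity_absolutelyContinuous _ _ (measure_singleton x)
    refine ⟨contDiffOn_transitionDensity hm hj hν0, fun k hk => ⟨?_, ?_⟩⟩
    · exact (memLp_congr_ae (ae_iteratedDeriv_transitionDensity ν hm hk)).2
        (memLp_transitionDeriv m j k hp hp' hνq hq)
    · refine (isLittleO_transitionDeriv m j ν k).congr' ?_ EventuallyEq.rfl
      filter_upwards [eventually_gt_atTop 0] with x hx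
      exact (iteratedDeriv_transitionDensity hm hk hx (hν0 x)).symm
  · intro hI
    have hlim := tendsto_transitionDensity_zero hm j hI
    refine ⟨fun hm2 => ?_, ?_, fun k hk =>
      (memLp_congr_ae (ae_iteratedDeriv_transitionDensity ν hm hk)).2
        (memLp_top_transitionDeriv m j k hI)⟩
    · have h0 : m - 1 ≠ 0 := by omega
      exact ⟨by simp [transitionDensity, h0], by simpa [h0] using hlim⟩
    -- Here x^(m-1) is 0^0 = 1 at the origin, so the value of the formula at 0 agrees with the
    -- limit.
    · rintro rfl
      exact ⟨by simp [transitionDensity], by simpa using hlim⟩
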